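/- Let $d\in\mathbb N$, let $\mathbb T^d=\mathbb R^d/2\pi\mathbb Z^d$ with normalized Lebesgue measure $\sigma$, and let $L_p(\mathbb T^d)$, $1\le p\le\infty$, be the usual space of complex-valued functions with norm $\|\cdot\|_p$ with respect to $\sigma$. For ${\bf k}\in\mathbb Z^d$ put $|{\bf k}|_1=\sum_{j=1}^d|k_j|$, ${\rm e}_{\bf k}({\bf x})={\rm e}^{{\rm i}(k_1x_1+\dots+k_dx_d)}$ and $\widehat f_{\bf k}=\int_{\mathbb T^d}f\,\overline{{\rm e}_{\bf k}}\,d\sigma$. Let $Y=\mathbb Z^d_+\cup\mathbb Z^d_-$ be the set of all ${\bf k}\in\mathbb Z^d$ whose coordinates are all nonnegative or all negative, and let $L_{p,Y}(\mathbb T^d)$ be the set of all $f\in L_p(\mathbb T^d)$ with $\widehat f_{\bf k}=0$ for ${\bf k}\notin Y$. For $f\in L_1(\mathbb T^d)$, $r\in\mathbb N$ and $\varrho\in[0,1)$ the Taylor--Abel--Poisson mean is $$A_{\varrho,r}(f)({\bf x})=\sum_{\nu=0}^\infty\lambda_{\nu,r}(\varrho)\sum_{|{\bf k}|_1=\nu}\widehat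 f_{\bf k}{\rm e}_{\bf k}({\bf x}),$$ where $\lambda_{\nu,r}(\varrho)=1$ for $\nu<r$ and $\lambda_{\nu,r}(\varrho)=\sum_{j=0}^{r-1}\binom{\nu}{j}(1-\varrho)^j\varrho^{\nu-j}$ for $\nu\ge r$. For an integer $m\ge0$, a function $g\in L_1(\mathbb T^d)$ is called the radial derivative $f^{[m]}$ of order $m$ of $f\in L_1(\mathbb T^d)$ if $\widehat g_{\bf k}=0$ when $|{\bf k}|_1=\nu<m$ and $\widehat g_{\bf k}=\frac{\nu!}{(\nu-m)!}\widehat f_{\bf k}$ when $|{\bf k}|_1=\nu\ge m$ (so $f^{[0]}=f$). For $n\in\mathbb N$, $\delta>0$ and $f\in L_p(\mathbb T^d)$ put $$K_n(\delta,f)_p=\inf\left\{\|f-h\|_p+\delta^n\|h^{[n]}\|_p:\ h\in L_p(\mathbb T^d),\ h^{[n]}\in L_p(\mathbb T^d)\right\}.$$ **Theorem.** Let $1\le p\le\infty$, $n,r\in\mathbb N$, $n\le r$, and let $f\in L_{p,Y}(\mathbb T^d)$. Let $\omega:[0,1]\to\mathbb R$ satisfy: 1) $\omega$ is continuous on $[0,1]$;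 2) $\omega$ is nondecreasing; 3) $\omega(t)\ne0$ for $t\in(0,1]$; 4) $\omega(t)\to0$ as $t\to0+$; $(\mathcal Z)$ the integral $\int_0^\delta\frac{\omega(t)}{t}\,dt$ converges and equals $\mathcal O(\omega(\delta))$ as $\delta\to0+$; $(\mathcal Z_n)$ $\int_\delta^1\frac{\omega(t)}{t^{n+1}}\,dt=\mathcal O\left(\frac{\omega(\delta)}{\delta^n}\right)$ as $\delta\to0+$. If $$\|f-A_{\varrho,r}(f)\|_p=\mathcal O\left((1-\varrho)^{r-n}\omega(1-\varrho)\right),\qquad \varrho\to1-,$$ then the radial derivative $f^{[r-n]}$ exists, belongs to $L_p(\mathbb T^d)$, and $$K_n\left(\delta,f^{[r-n]}\right)_p=\mathcal O(\omega(\delta)),\qquad\delta\to0+.$$ -/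

import Mathlib

open MeasureTheory Filter Topology Asymptotics
open scoped ENNReal

noncomputable section

instance instFactZeroLtTwoPi : Fact ((0 : ℝ) < 2 * Real.pi) := ⟨Real.two_pi_pos⟩

/-- The torus `𝕋ᵈ = ℝᵈ / 2πℤᵈ`. -/
abbrev Torus (d : ℕ) : Type := Fin d → AddCircle (2 * Real.pi)

/-- The normalized Lebesgue measure on `𝕋ᵈ`. -/
def torusMeasure (d : ℕ) : Measure (Torus d) :=
  Measure.pi fun _ : Fin d => (AddCircle.haarAddCircle : Measure (AddCircle (2 * Real.pi)))

/-- The norm of `L_p(𝕋ᵈ)`; it is only used for functions that belong to `L_p(𝕋ᵈ)`. -/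
def torusNorm {d : ℕ} (p : ℝ≥0∞) (f : Torus d → ℂ) : ℝ :=
  lpNorm f p (torusMeasure d)

/-- The exponential `e_k(x) = exp(i (k, x))`. -/
def expMonomial {d : ℕ} (k : Fin d → ℤ) (x : Torus d) : ℂ :=
  ∏ j, fourier (k j) (x j)

/-- The Fourier coefficient `∫ f(x) conj(e_k(x)) dσ(x)`. -/
def torusCoeff {d : ℕ} (f : Torus d → ℂ) (k : Fin d → ℤ) : ℂ :=
  ∫ x, f x * (starRingEnd ℂ) (expMonomial k x) ∂(torusMeasure d)

/-- `|k|₁ = |k_1| + ⋯ + |k_d|`. -/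
def l1Norm {d : ℕ} (k : Fin d → ℤ) : ℕ := ∑ j, (k j).natAbs

/-- The finite set of all `k ∈ ℤᵈ` with `|k|₁ = ν`. -/
def l1Sphere (d ν : ℕ) : Finset (Fin d → ℤ) :=
  (Fintype.piFinset fun _ : Fin d => Finset.Icc (-(ν : ℤ)) (ν : ℤ)).filter fun k => l1Norm k = ν

theorem mem_l1Sphere {d ν : ℕ} {k : Fin d → ℤ} : k ∈ l1Sphere d ν ↔ l1Norm k = ν := by
  simp only [l1Sphere, Finset.mem_filter, Fintype.mem_piFinset, Finset.mem_Icc,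
    and_iff_right_iff_imp]
  intro h j
  have hj : (k j).natAbs ≤ ν := by
    rw [← h]
    exact Finset.single_le_sum (f := fun j => (k j).natAbs) (fun _ _ => Nat.zero_le _)
      (Finset.mem_univ j)
  omega

/-- `Y = ℤᵈ₊ ∪ ℤᵈ₋`: all coordinates are nonnegative, or all coordinates are negative. -/
def spectrumY (d : ℕ) : Set (Fin d → ℤ) :=
  {k | ∀ j, 0 ≤ k j} ∪ {k | ∀ j, k j < 0}

/-- The space `L_{p,Y}(𝕋ᵈ)`: functions in `L_p(𝕋ᵈ)` whose Fourier coefficients vanish off `Y`. -/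
structure MemLpY {d : ℕ} (p : ℝ≥0∞) (f : Torus d → ℂ) : Prop where
  memLp : MemLp f p (torusMeasure d)
  coeff_eq_zero : ∀ k, k ∉ spectrumY d → torusCoeff f k = 0

/-- The numbers `λ_{ν,r}(ϱ)`. -/
def tapLambda (r ν : ℕ) (ϱ : ℝ) : ℝ :=
  if ν < r then 1
  else ∑ j ∈ Finset.range r, (ν.choose j : ℝ) * (1 - ϱ) ^ j * ϱ ^ (ν - j)

/-- The Taylor-Abel-Poisson mean
`A_{ϱ,r}(f)(x) = ∑_ν λ_{ν,r}(ϱ) ∑_{|k|₁ = ν} f̂_k e_k(x)`; for integrable `f` and `0 ≤ ϱ < 1` the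
series converges absolutely and uniformly in `x`. -/
def tapMean {d : ℕ} (ϱ : ℝ) (r : ℕ) (f : Torus d → ℂ) (x : Torus d) : ℂ :=
  ∑' ν : ℕ, (tapLambda r ν ϱ : ℂ) * ∑ k ∈ l1Sphere d ν, torusCoeff f k * expMonomial k x

/-- `g` is the radial derivative `f^{[m]}` of order `m` of `f ∈ L_1(𝕋ᵈ)`; it is determined by `f`
up to equality almost everywhere, and `f^{[0]} = f`. -/
structure IsRadialDeriv {d : ℕ} (m : ℕ) (f g : Torus d → ℂ) : Prop where
  integrable_left : Integrable f (torusMeasure d)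
  integrable_right : Integrable g (torusMeasure d)
  coeff_eq : ∀ k, torusCoeff g k =
    if l1Norm k < m then 0
    else ((Nat.factorial (l1Norm k) : ℂ) / (Nat.factorial (l1Norm k - m) : ℂ)) * torusCoeff f k

/-- The `K`-functional `K_n(δ, f)_p`: the infimum of `‖f - h‖_p + δⁿ ‖h^{[n]}‖_p` over all
`h ∈ L_p(𝕋ᵈ)` with `h^{[n]} ∈ L_p(𝕋ᵈ)`. -/
def kFunctional {d : ℕ} (n : ℕ) (p : ℝ≥0∞) (δ : ℝ) (f : Torus d → ℂ) : ℝ :=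
  sInf {a : ℝ | ∃ h g : Torus d → ℂ, MemLp h p (torusMeasure d) ∧ MemLp g p (torusMeasure d) ∧
    IsRadialDeriv n h g ∧ a = torusNorm p (f - h) + δ ^ n * torusNorm p g}

/-- Conditions 1)-4) on a function `ω` on `[0, 1]`. -/
structure IsMajorant (ω : ℝ → ℝ) : Prop where
  continuousOn : ContinuousOn ω (Set.Icc 0 1)
  monotoneOn : MonotoneOn ω (Set.Icc 0 1)
  ne_zero : ∀ t ∈ Set.Ioc (0 : ℝ) 1, ω t ≠ 0
  tendsto_zero : Tendsto ω (𝓝[>] 0) (𝓝 0)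

/-- Condition `(𝒵)`: the integral `∫₀^δ ω(t)/t dt` converges and is `O(ω(δ))` as `δ → 0+`. -/
structure CondZ (ω : ℝ → ℝ) : Prop where
  integrableOn : IntegrableOn (fun t => ω t / t) (Set.Ioc 0 1) volume
  isBigO : (fun δ : ℝ => ∫ t in (0 : ℝ)..δ, ω t / t) =O[𝓝[>] 0] ω

/-- Condition `(𝒵_n)`: `∫_δ^1 ω(t)/t^{n+1} dt = O(ω(δ)/δⁿ)` as `δ → 0+`. -/
def CondZn (n : ℕ) (ω : ℝ → ℝ) : Prop :=
  (fun δ : ℝ => ∫ t in δ..1, ω t / t ^ (n + 1)) =O[𝓝[>] 0] fun δ => ω δ / δ ^ n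

end

/-!
# The inverse theorem for Taylor–Abel–Poisson means

The argument is the classical dyadic one, carried out with radial Fourier multipliers
`f ↦ ∑_k a(|k|₁) f̂_k e_k` (`radialMult`).

*Bernstein's inequality.* The Poisson kernel `∑_k ϱ^{|k|₁} e_k` of the torus is a product of Poisson
kernels of the circle, hence nonnegative with integral one. On the circle
`|∑_k |k| ϱ^{|k|} e^{iky}| ≤ 2 (1 - ϱ)⁻¹ ∑_k ϱ^{|k|} e^{iky}`, so on the torus the symbol `ν ϱ^ν`
has norm `O((1 - ϱ)⁻¹)` on every `L_p`. Writing `ϱ^ν` as a product of two powers of `√ϱ` shows that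
this kind of bound is multiplicative (`PoissonOrder.mul`), and since `λ_{ν,r}(ϱ)` is a combination
of `binom(ν, j) (1 - ϱ)^j ϱ^{ν-j}`, a radial derivative of order `s` of `A_{ϱ,r}(f)` costs a factor
`O((1 - ϱ)^{-s})` (`PoissonOrder.exists_bound_mul_tapLambda`).

*Increments.* Let `A_j` be the mean at `ϱ = 1 - 2^{-j}`. The increments `A_{j+1} f - A_j f` are not
polynomials, but as the means commute they equal `A_{j+1}(f - A_j f) - A_j(f - A_{j+1} f)`, and
Bernstein's inequality applies to both terms. With `m = r - n`, the radial derivative of order `m`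
of the increment is `O(ω(2^{-j}))`, and its further derivative of order `n` is `O(2^{jn} ω(2^{-j}))`.

*Conclusion.* By `(𝒵)` the derivatives `(A_j f)^{[m]}` converge in `L_p`; Fourier coefficients
identify the limit as `f^{[m]}`, and the tail of the series is `O(ω(2^{-N}))`. By `(𝒵_n)` the
functions `h = (A_N f)^{[m]}` satisfy `‖h^{[n]}‖ = O(2^{Nn} ω(2^{-N}))`. Taking `2^{-N} ≈ δ` in the
`K`-functional gives the theorem.
-/

/-! ### Characters and Fourier coefficients on the torus -/

instance instIsProbabilityMeasureTorusMeasure (d : ℕ) : IsProbabilityMeasure (torusMeasure d) := by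
  unfold torusMeasure; infer_instance

theorem continuous_expMonomial {d : ℕ} (k : Fin d → ℤ) : Continuous (expMonomial k) := by
  unfold expMonomial; fun_prop

theorem norm_expMonomial {d : ℕ} (k : Fin d → ℤ) (x : Torus d) : ‖expMonomial k x‖ = 1 := by
  rw [expMonomial, norm_prod]
  exact Finset.prod_eq_one fun j _ => Circle.norm_coe _

theorem expMonomial_sub {d : ℕ} (k : Fin d → ℤ) (x y : Torus d) :
    expMonomial k (x - y) = expMonomial k x * (starRingEnd ℂ) (expMonomial k y) := by
  simp only [expMonomial, map_prod, ← Finset.prod_mul_distrib]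
  refine Finset.prod_congr rfl fun j _ => ?_
  rw [← fourier_neg]
  simp [fourier_apply, sub_eq_add_neg, AddCircle.toCircle_add]

theorem integrable_mul_conj_expMonomial {d : ℕ} {f : Torus d → ℂ}
    (hf : Integrable f (torusMeasure d)) (k : Fin d → ℤ) :
    Integrable (fun x => f x * (starRingEnd ℂ) (expMonomial k x)) (torusMeasure d) := by
  refine hf.mul_bdd (c := 1) ?_ ?_
  · exact (Complex.continuous_conj.comp (continuous_expMonomial k)).aestronglyMeasurable
  · exact .of_forall fun x => by simp [norm_expMonomial]

theorem norm_torusCoeff_le {d : ℕ} (f : Torus d → ℂ) (k : Fin d → ℤ) :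
    ‖torusCoeff f k‖ ≤ ∫ x, ‖f x‖ ∂(torusMeasure d) := by
  refine (norm_integral_le_integral_norm _).trans_eq ?_
  simp [norm_expMonomial]

theorem torusCoeff_sub {d : ℕ} {f g : Torus d → ℂ} (hf : Integrable f (torusMeasure d))
    (hg : Integrable g (torusMeasure d)) (k : Fin d → ℤ) :
    torusCoeff (f - g) k = torusCoeff f k - torusCoeff g k := by
  rw [torusCoeff, torusCoeff, torusCoeff, ← integral_sub (integrable_mul_conj_expMonomial hf k)
    (integrable_mul_conj_expMonomial hg k)]
  simp [sub_mul]

theorem torusCoeff_expMonomial {d : ℕ} (l k : Fin d → ℤ) :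
    torusCoeff (expMonomial l) k = if l = k then 1 else 0 := by
  have h1 : ∀ x : Torus d, expMonomial l x * (starRingEnd ℂ) (expMonomial k x)
      = ∏ j, (fun y : AddCircle (2 * Real.pi) => (fourier (-(k j)) y * fourier (l j) y)) (x j) := by
    intro x
    simp only [expMonomial, map_prod, ← Finset.prod_mul_distrib]
    exact Finset.prod_congr rfl fun j _ => by rw [← fourier_neg, mul_comm]
  have h2 : ∀ j, ∫ y : AddCircle (2 * Real.pi), fourier (-(k j)) y * fourier (l j) y
      ∂AddCircle.haarAddCircle = if l j = k j then 1 else 0 := by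
    intro j
    have := congrFun (fourierCoeff_fourier (T := 2 * Real.pi) (l j)) (k j)
    rw [fourierCoeff] at this
    simp only [smul_eq_mul] at this
    rw [this, Pi.single_apply]
    simp [eq_comm]
  rw [torusCoeff, torusMeasure]
  simp_rw [h1]
  rw [integral_fintype_prod_eq_prod (𝕜 := ℂ)
    (fun j (y : AddCircle (2 * Real.pi)) => (fourier (-(k j)) y * fourier (l j) y))]
  simp_rw [h2]
  split_ifs with h
  · subst h; simp
  · obtain ⟨j, hj⟩ := Function.ne_iff.1 h
    exact Finset.prod_eq_zero (Finset.mem_univ j) (by simp [hj])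

/-! ### Radial Fourier multipliers -/

/-- The radial multiplier operator with symbol `a`, `f ↦ ∑_k a(|k|₁) f̂_k e_k`. It is used for
symbols with `∑_k |a(|k|₁)| < ∞`, when the series converges absolutely and uniformly. -/
noncomputable def radialMult {d : ℕ} (a : ℕ → ℝ) (f : Torus d → ℂ) (x : Torus d) : ℂ :=
  ∑' k : Fin d → ℤ, (a (l1Norm k) : ℂ) * torusCoeff f k * expMonomial k x

/-- Absolute summability of a radial symbol over the lattice `ℤᵈ`. -/
def RadialSummable (d : ℕ) (a : ℕ → ℝ) : Prop :=
  Summable fun k : Fin d → ℤ => a (l1Norm k)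

theorem RadialSummable.add {d : ℕ} {a b : ℕ → ℝ} (ha : RadialSummable d a)
    (hb : RadialSummable d b) : RadialSummable d (a + b) :=
  Summable.add ha hb

theorem RadialSummable.mul {d : ℕ} {a b : ℕ → ℝ} (ha : RadialSummable d a)
    (hb : RadialSummable d b) : RadialSummable d (a * b) := by
  refine .of_norm_bounded ((Summable.abs ha).mul_right (∑' k : Fin d → ℤ, |b (l1Norm k)|))
    fun k => ?_
  rw [Pi.mul_apply, norm_mul, Real.norm_eq_abs, Real.norm_eq_abs]
  gcongr
  exact (Summable.abs hb).le_tsum k fun _ _ => abs_nonneg _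

theorem RadialSummable.norm_bound {d : ℕ} {a : ℕ → ℝ} (ha : RadialSummable d a)
    (f : Torus d → ℂ) :
    Summable fun k : Fin d → ℤ => |a (l1Norm k)| * ∫ x, ‖f x‖ ∂(torusMeasure d) :=
  (Summable.abs ha).mul_right _

/-- The majorant behind the absolute and uniform convergence of the series. -/
theorem norm_radialMult_term_le {d : ℕ} (a : ℕ → ℝ) (f : Torus d → ℂ) (k : Fin d → ℤ)
    (x : Torus d) :
    ‖(a (l1Norm k) : ℂ) * torusCoeff f k * expMonomial k x‖
      ≤ |a (l1Norm k)| * ∫ x, ‖f x‖ ∂(torusMeasure d) := by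
  rw [norm_mul, norm_mul, norm_expMonomial, mul_one, Complex.norm_real, Real.norm_eq_abs]
  gcongr
  exact norm_torusCoeff_le f k

theorem RadialSummable.summable_term {d : ℕ} {a : ℕ → ℝ} (ha : RadialSummable d a)
    (f : Torus d → ℂ) (x : Torus d) :
    Summable fun k : Fin d → ℤ => (a (l1Norm k) : ℂ) * torusCoeff f k * expMonomial k x :=
  .of_norm_bounded (ha.norm_bound f) fun k => norm_radialMult_term_le a f k x

theorem continuous_radialMult {d : ℕ} {a : ℕ → ℝ} (ha : RadialSummable d a) (f : Torus d → ℂ) :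
    Continuous (radialMult a f) :=
  continuous_tsum (fun k => continuous_const.mul (continuous_expMonomial k)) (ha.norm_bound f)
    fun k x => norm_radialMult_term_le a f k x

theorem memLp_of_continuous {d : ℕ} {f : Torus d → ℂ} (hf : Continuous f) (p : ℝ≥0∞) :
    MemLp f p (torusMeasure d) := by
  obtain ⟨C, hC⟩ := isCompact_univ.exists_bound_of_continuousOn hf.continuousOn
  exact .of_bound hf.aestronglyMeasurable C (.of_forall fun x => hC x trivial)

theorem memLp_radialMult {d : ℕ} {a : ℕ → ℝ} (ha : RadialSummable d a) (f : Torus d → ℂ)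
    (p : ℝ≥0∞) : MemLp (radialMult a f) p (torusMeasure d) :=
  memLp_of_continuous (continuous_radialMult ha f) p

theorem integrable_radialMult {d : ℕ} {a : ℕ → ℝ} (ha : RadialSummable d a) (f : Torus d → ℂ) :
    Integrable (radialMult a f) (torusMeasure d) :=
  memLp_one_iff_integrable.1 (memLp_radialMult ha f 1)

theorem torusCoeff_radialMult {d : ℕ} {a : ℕ → ℝ} (ha : RadialSummable d a) (f : Torus d → ℂ)
    (k : Fin d → ℤ) : torusCoeff (radialMult a f) k = a (l1Norm k) * torusCoeff f k := by
  let F : (Fin d → ℤ) → Torus d → ℂ := fun l x =>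
    (a (l1Norm l) * torusCoeff f l) * (expMonomial l x * (starRingEnd ℂ) (expMonomial k x))
  have hF : ∀ l, Continuous (F l) := fun l => continuous_const.mul
    ((continuous_expMonomial l).mul (Complex.continuous_conj.comp (continuous_expMonomial k)))
  have hb : ∀ l x, ‖F l x‖ ≤ |a (l1Norm l)| * ∫ x, ‖f x‖ ∂(torusMeasure d) := by
    intro l x
    refine (norm_radialMult_term_le a f l x).trans' (le_of_eq ?_)
    simp [F, norm_expMonomial]
  have hsum : Summable fun l => ∫ x, ‖F l x‖ ∂(torusMeasure d) := by
    refine .of_nonneg_of_le (fun l => integral_nonneg fun x => norm_nonneg _) (fun l => ?_)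
      (ha.norm_bound f)
    refine (integral_mono (memLp_one_iff_integrable.1 (memLp_of_continuous (hF l) 1)).norm
      (integrable_const _) (hb l)).trans_eq ?_
    simp
  have key := integral_tsum_of_summable_integral_norm (μ := torusMeasure d)
    (fun l => memLp_one_iff_integrable.1 (memLp_of_continuous (hF l) 1)) hsum
  have h1 : ∀ l, ∫ x, F l x ∂(torusMeasure d)
      = (a (l1Norm l) * torusCoeff f l) * if l = k then 1 else 0 := by
    intro l
    rw [← torusCoeff_expMonomial]
    exact integral_const_mul _ _
  simp_rw [h1] at key
  rw [tsum_eq_single k (by intro l hl; simp [hl])] at key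
  rw [torusCoeff]
  simp only [if_true, mul_one] at key
  rw [key]
  refine integral_congr_ae (.of_forall fun x => ?_)
  simp only [radialMult, F, ← tsum_mul_right]
  exact tsum_congr fun l => by ring

theorem radialMult_comp {d : ℕ} (a : ℕ → ℝ) {b : ℕ → ℝ} (hb : RadialSummable d b)
    (f : Torus d → ℂ) : radialMult a (radialMult b f) = radialMult (a * b) f := by
  funext x
  refine tsum_congr fun k => ?_
  rw [torusCoeff_radialMult hb]
  simp only [Pi.mul_apply]
  push_cast; ring

theorem radialMult_add {d : ℕ} {a b : ℕ → ℝ} (ha : RadialSummable d a) (hb : RadialSummable d b)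
    (f : Torus d → ℂ) : radialMult (a + b) f = radialMult a f + radialMult b f := by
  funext x
  rw [Pi.add_apply, radialMult, radialMult, radialMult,
    ← (ha.summable_term f x).tsum_add (hb.summable_term f x)]
  exact tsum_congr fun k => by simp only [Pi.add_apply]; push_cast; ring

theorem radialMult_smul {d : ℕ} (c : ℝ) (a : ℕ → ℝ) (f : Torus d → ℂ) :
    radialMult (c • a) f = c • radialMult a f := by
  funext x
  rw [Pi.smul_apply, radialMult, radialMult, Complex.real_smul, ← tsum_mul_left]
  exact tsum_congr fun k => by simp only [Pi.smul_apply, smul_eq_mul]; push_cast; ring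

theorem radialMult_sub {d : ℕ} {a : ℕ → ℝ} (ha : RadialSummable d a) {f g : Torus d → ℂ}
    (hf : Integrable f (torusMeasure d)) (hg : Integrable g (torusMeasure d)) :
    radialMult a (f - g) = radialMult a f - radialMult a g := by
  funext x
  rw [Pi.sub_apply, radialMult, radialMult, radialMult,
    ← (ha.summable_term f x).tsum_sub (ha.summable_term g x)]
  exact tsum_congr fun k => by rw [torusCoeff_sub hf hg]; ring

/-- Summation over the spheres `|k|₁ = ν` may be replaced by unconditional summation over `ℤᵈ`. -/
theorem tapMean_eq_radialMult {d r : ℕ} {ϱ : ℝ} (h : RadialSummable d fun ν => tapLambda r ν ϱ)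
    (f : Torus d → ℂ) : tapMean ϱ r f = radialMult (fun ν => tapLambda r ν ϱ) f := by
  funext x
  have h1 := ((h.summable_term f x).hasSum.tsum_fiberwise l1Norm).tsum_eq
  rw [radialMult, ← h1, tapMean]
  refine tsum_congr fun ν => ?_
  have h2 : l1Norm (d := d) ⁻¹' {ν} = (l1Sphere d ν : Set (Fin d → ℤ)) := by
    ext k; simp [mem_l1Sphere]
  rw [h2, Finset.tsum_subtype' (l1Sphere d ν)
    fun k => (tapLambda r (l1Norm k) ϱ : ℂ) * torusCoeff f k * expMonomial k x, Finset.mul_sum]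
  refine Finset.sum_congr rfl fun k hk => ?_
  rw [mem_l1Sphere.1 hk, mul_assoc]

/-! ### Kernel estimate in `L_p` -/

/-- Integral operators with a doubly stochastic kernel `k` are contractions of `L_p`: by Jensen's
inequality for the probability measures `k(x, y) dμ(y)`, followed by Tonelli's theorem. -/
theorem eLpNorm_le_of_doublyStochastic {X E F : Type*} [MeasurableSpace X] {μ : Measure X}
    [SFinite μ] [NormedAddCommGroup E] [NormedAddCommGroup F] {k : X → X → ℝ≥0∞}
    (hk : Measurable (Function.uncurry k)) (hk1 : ∀ x, ∫⁻ y, k x y ∂μ = 1)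
    (hk2 : ∀ y, ∫⁻ x, k x y ∂μ = 1) {p : ℝ≥0∞} (hp : 1 ≤ p) {g : X → E} {f : X → F}
    (hg : AEStronglyMeasurable g μ) {C : ℝ≥0∞}
    (hfg : ∀ x, ‖f x‖ₑ ≤ C * ∫⁻ y, k x y * ‖g y‖ₑ ∂μ) :
    eLpNorm f p μ ≤ C * eLpNorm g p μ := by
  have hkx : ∀ x, Measurable (k x) := fun x => hk.comp measurable_prodMk_left
  rcases eq_or_ne p ∞ with rfl | hp'
  · rw [eLpNorm_exponent_top, eLpNorm_exponent_top]
    refine essSup_le_of_ae_le _ (.of_forall fun x => (hfg x).trans (mul_le_mul_right ?_ C))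
    calc ∫⁻ y, k x y * ‖g y‖ₑ ∂μ ≤ ∫⁻ y, k x y * eLpNormEssSup g μ ∂μ := by
          refine lintegral_mono_ae ?_
          filter_upwards [enorm_ae_le_eLpNormEssSup g μ] with y hy
          gcongr
      _ = eLpNormEssSup g μ := by rw [lintegral_mul_const _ (hkx x), hk1, one_mul]
  have hp0 : p ≠ 0 := (zero_lt_one.trans_le hp).ne'
  have hpr : 0 < p.toReal := ENNReal.toReal_pos hp0 hp'
  have jensen : ∀ x, (∫⁻ y, k x y * ‖g y‖ₑ ∂μ) ^ p.toReal
      ≤ ∫⁻ y, k x y * ‖g y‖ₑ ^ p.toReal ∂μ := by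
    intro x
    have : IsProbabilityMeasure (μ.withDensity (k x)) :=
      ⟨by rw [withDensity_apply _ .univ, Measure.restrict_univ, hk1]⟩
    have hac : μ.withDensity (k x) ≪ μ := withDensity_absolutelyContinuous _ _
    have h := eLpNorm_le_eLpNorm_of_exponent_le hp (hg.mono_ac hac)
    rw [eLpNorm_one_eq_lintegral_enorm, eLpNorm_eq_lintegral_rpow_enorm_toReal hp0 hp',
      lintegral_withDensity_eq_lintegral_mul₀ (hkx x).aemeasurable hg.enorm,
      lintegral_withDensity_eq_lintegral_mul₀ (hkx x).aemeasurable
        (hg.enorm.pow_const _)] at h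
    rw [one_div] at h
    exact (ENNReal.le_rpow_inv_iff hpr).1 h
  rw [eLpNorm_eq_lintegral_rpow_enorm_toReal hp0 hp',
    eLpNorm_eq_lintegral_rpow_enorm_toReal hp0 hp', one_div]
  rw [ENNReal.rpow_inv_le_iff hpr, ENNReal.mul_rpow_of_nonneg _ _ hpr.le,
    ← ENNReal.rpow_mul, inv_mul_cancel₀ hpr.ne', ENNReal.rpow_one]
  calc ∫⁻ x, ‖f x‖ₑ ^ p.toReal ∂μ
      ≤ ∫⁻ x, C ^ p.toReal * ∫⁻ y, k x y * ‖g y‖ₑ ^ p.toReal ∂μ ∂μ := by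
        refine lintegral_mono fun x => ?_
        refine (ENNReal.rpow_le_rpow (hfg x) hpr.le).trans ?_
        rw [ENNReal.mul_rpow_of_nonneg _ _ hpr.le]
        gcongr
        exact jensen x
    _ = C ^ p.toReal * ∫⁻ x, ∫⁻ y, k x y * ‖g y‖ₑ ^ p.toReal ∂μ ∂μ := by
        refine lintegral_const_mul'' _ ?_
        exact AEMeasurable.lintegral_prod_right'
          (hk.aemeasurable.mul ((hg.enorm.pow_const _).comp_snd))
    _ = C ^ p.toReal * ∫⁻ y, ∫⁻ x, k x y * ‖g y‖ₑ ^ p.toReal ∂μ ∂μ := by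
        rw [lintegral_lintegral_swap]
        exact hk.aemeasurable.mul ((hg.enorm.pow_const _).comp_snd)
    _ = C ^ p.toReal * ∫⁻ y, ‖g y‖ₑ ^ p.toReal ∂μ := by
        congr 1
        refine lintegral_congr fun y => ?_
        have hky : Measurable fun x => k x y := hk.comp measurable_prodMk_right
        rw [lintegral_mul_const _ hky, hk2, one_mul]

/-! ### The Poisson kernel -/

/-- Products of absolutely convergent series are summable over `Fin d → ι`. -/
theorem hasSum_pi_prod {ι : Type*} {d : ℕ} {f : Fin d → ι → ℂ}
    (hf : ∀ j, Summable fun k => ‖f j k‖) :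
    (Summable fun k : Fin d → ι => ‖∏ j, f j (k j)‖) ∧
      HasSum (fun k : Fin d → ι => ∏ j, f j (k j)) (∏ j, ∑' k, f j k) := by
  induction d with
  | zero =>
    refine ⟨(hasSum_fintype _).summable, ?_⟩
    simp
  | succ d ih =>
    obtain ⟨h1, h2⟩ := ih (f := fun j => f j.succ) fun j => hf _
    have h3 := (hf 0).mul_norm h1
    have h4 := h3.of_norm
    have h5 := (hf 0).of_norm.hasSum.mul h2 h4
    refine ⟨(Fin.consEquiv fun _ => ι).summable_iff.1 ?_,
      (Fin.consEquiv fun _ => ι).hasSum_iff.1 ?_⟩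
    · refine h3.congr fun k => ?_
      simp [Fin.prod_univ_succ, Fin.consEquiv]
    · rw [Fin.prod_univ_succ]
      refine HasSum.congr_fun h5 fun k => ?_
      simp [Fin.prod_univ_succ, Fin.consEquiv]

/-- The Poisson kernel of the circle, in closed form. -/
noncomputable def circlePoisson (ϱ : ℝ) (y : AddCircle (2 * Real.pi)) : ℝ :=
  (1 - ϱ ^ 2) / ‖1 - (ϱ : ℂ) * fourier 1 y‖ ^ 2

theorem norm_mul_fourier_one {ϱ : ℝ} (h0 : 0 ≤ ϱ) (y : AddCircle (2 * Real.pi)) :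
    ‖(ϱ : ℂ) * fourier 1 y‖ = ϱ := by
  rw [norm_mul, Complex.norm_real, Real.norm_of_nonneg h0, fourier_apply, Circle.norm_coe, mul_one]

theorem one_sub_mul_fourier_ne_zero {ϱ : ℝ} (h0 : 0 ≤ ϱ) (h1 : ϱ < 1)
    (y : AddCircle (2 * Real.pi)) : 1 - (ϱ : ℂ) * fourier 1 y ≠ 0 := by
  intro h
  have := norm_mul_fourier_one h0 y
  rw [← sub_eq_zero.1 h, norm_one] at this
  exact h1.ne' this

theorem fourier_natCast (n : ℕ) (y : AddCircle (2 * Real.pi)) :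
    (fourier (n : ℤ) y : ℂ) = fourier 1 y ^ n := by
  induction n with
  | zero => simp
  | succ n ih => rw [Nat.cast_succ, fourier_add, ih, pow_succ]

theorem hasSum_circlePoisson {ϱ : ℝ} (h0 : 0 ≤ ϱ) (h1 : ϱ < 1) (y : AddCircle (2 * Real.pi)) :
    HasSum (fun k : ℤ => (ϱ : ℂ) ^ k.natAbs * fourier k y) (circlePoisson ϱ y) := by
  set z : ℂ := ϱ * fourier 1 y with hz
  have hzn : ‖z‖ = ϱ := norm_mul_fourier_one h0 y
  have hz1 : 1 - z ≠ 0 := one_sub_mul_fourier_ne_zero h0 h1 y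
  have hw1 : 1 - (starRingEnd ℂ) z ≠ 0 := by
    rwa [← map_one (starRingEnd ℂ), ← map_sub, map_ne_zero]
  have hval : (circlePoisson ϱ y : ℂ)
      = (1 - z)⁻¹ + (starRingEnd ℂ) z * (1 - (starRingEnd ℂ) z)⁻¹ := by
    have e1 : ((‖1 - z‖ ^ 2 : ℝ) : ℂ) = (1 - z) * (1 - (starRingEnd ℂ) z) := by
      have := Complex.mul_conj (1 - z)
      rw [map_sub, map_one, Complex.normSq_eq_norm_sq] at this
      exact this.symm
    have e2 : ((ϱ ^ 2 : ℝ) : ℂ) = z * (starRingEnd ℂ) z := by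
      rw [Complex.mul_conj, Complex.normSq_eq_norm_sq, hzn]
    rw [circlePoisson, ← hz, Complex.ofReal_div, Complex.ofReal_sub, e1, e2, Complex.ofReal_one]
    field_simp
    ring
  rw [hval]
  refine HasSum.of_nat_of_neg_add_one ?_ ?_
  · refine HasSum.congr_fun (hasSum_geometric_of_norm_lt_one (hzn.trans_lt h1)) fun n => ?_
    rw [Int.natAbs_natCast, fourier_natCast, ← mul_pow]
  · have hw : ‖(starRingEnd ℂ) z‖ < 1 := by rw [RCLike.norm_conj, hzn]; exact h1
    refine HasSum.congr_fun ((hasSum_geometric_of_norm_lt_one hw).mul_left _) fun n => ?_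
    have : (-((n : ℤ) + 1)).natAbs = n + 1 := by omega
    rw [this, fourier_neg, ← Nat.cast_succ, fourier_natCast, hz, map_mul, map_pow,
      Complex.conj_ofReal, Nat.succ_eq_add_one]
    ring

/-- The kernel `∑_k |k| ϱ^|k| e^{iky}` is dominated pointwise by a multiple of the Poisson kernel,
because both have the denominator `|1 - ϱ e^{iy}|²`. -/
theorem exists_hasSum_natAbs_mul_circlePoisson {ϱ : ℝ} (h0 : 0 ≤ ϱ) (h1 : ϱ < 1)
    (y : AddCircle (2 * Real.pi)) :
    ∃ q : ℂ, HasSum (fun k : ℤ => (k.natAbs : ℂ) * (ϱ : ℂ) ^ k.natAbs * fourier k y) q ∧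
      ‖q‖ ≤ 2 / (1 - ϱ) * circlePoisson ϱ y := by
  set z : ℂ := ϱ * fourier 1 y with hz
  have hzn : ‖z‖ = ϱ := norm_mul_fourier_one h0 y
  have hz1 : 1 - z ≠ 0 := one_sub_mul_fourier_ne_zero h0 h1 y
  set w : ℂ := (starRingEnd ℂ) z with hwz
  have hwn : ‖w‖ = ϱ := by rw [hwz, RCLike.norm_conj, hzn]
  refine ⟨z / (1 - z) ^ 2 + w / (1 - w) ^ 2, HasSum.of_nat_of_neg_add_one ?_ ?_, ?_⟩
  · refine HasSum.congr_fun (hasSum_coe_mul_geometric_of_norm_lt_one (hzn.trans_lt h1)) fun n => ?_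
    rw [Int.natAbs_natCast, fourier_natCast, mul_assoc, ← mul_pow]
  · have h := hasSum_coe_mul_geometric_of_norm_lt_one (hwn.trans_lt h1)
    rw [← hasSum_nat_add_iff' 1] at h
    simp only [Finset.range_one, Finset.sum_singleton, Nat.cast_zero, zero_mul, sub_zero] at h
    refine HasSum.congr_fun h fun n => ?_
    have : (-((n : ℤ) + 1)).natAbs = n + 1 := by omega
    rw [this, fourier_neg, ← Nat.cast_succ, fourier_natCast, hwz, hz, map_mul, map_pow,
      Complex.conj_ofReal, Nat.succ_eq_add_one]
    ring
  · have e1 : ‖1 - w‖ = ‖1 - z‖ := by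
      rw [hwz, ← map_one (starRingEnd ℂ), ← map_sub, RCLike.norm_conj]; simp
    have hpos : 0 < ‖1 - z‖ := norm_pos_iff.2 hz1
    calc ‖z / (1 - z) ^ 2 + w / (1 - w) ^ 2‖
        ≤ ‖z / (1 - z) ^ 2‖ + ‖w / (1 - w) ^ 2‖ := norm_add_le _ _
      _ = 2 * ϱ / ‖1 - z‖ ^ 2 := by
          rw [norm_div, norm_div, norm_pow, norm_pow, e1, hzn, hwn]; ring
      _ ≤ 2 * (1 + ϱ) / ‖1 - z‖ ^ 2 := by gcongr; linarith
      _ = 2 / (1 - ϱ) * circlePoisson ϱ y := by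
          have : 1 - ϱ ≠ 0 := by linarith
          rw [circlePoisson, ← hz]
          field_simp
          ring

theorem circlePoisson_pos {ϱ : ℝ} (h0 : 0 ≤ ϱ) (h1 : ϱ < 1) (y : AddCircle (2 * Real.pi)) :
    0 < circlePoisson ϱ y := by
  have := norm_pos_iff.2 (one_sub_mul_fourier_ne_zero h0 h1 y)
  have : 0 < 1 - ϱ ^ 2 := by nlinarith
  rw [circlePoisson]; positivity

theorem continuous_circlePoisson {ϱ : ℝ} (h0 : 0 ≤ ϱ) (h1 : ϱ < 1) :
    Continuous (circlePoisson ϱ) := by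
  unfold circlePoisson
  refine continuous_const.div (by fun_prop) fun y => ?_
  exact pow_ne_zero _ (norm_ne_zero_iff.2 (one_sub_mul_fourier_ne_zero h0 h1 y))

theorem circlePoisson_neg (ϱ : ℝ) (y : AddCircle (2 * Real.pi)) :
    circlePoisson ϱ (-y) = circlePoisson ϱ y := by
  have h : (fourier 1 (-y) : ℂ) = (starRingEnd ℂ) (fourier 1 y) := by
    rw [← fourier_neg, fourier_apply, fourier_apply]; simp
  rw [circlePoisson, circlePoisson, h]
  congr 2
  rw [← RCLike.norm_conj]
  simp

/-- The Poisson kernel `∑_k ϱ^{|k|₁} e_k` of the torus `𝕋ᵈ`: the product of the kernels of the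
coordinates. -/
noncomputable def torusPoisson {d : ℕ} (ϱ : ℝ) (x : Torus d) : ℝ := ∏ j, circlePoisson ϱ (x j)

theorem torusPoisson_nonneg {d : ℕ} {ϱ : ℝ} (h0 : 0 ≤ ϱ) (h1 : ϱ < 1) (x : Torus d) :
    0 ≤ torusPoisson ϱ x :=
  Finset.prod_nonneg fun j _ => (circlePoisson_pos h0 h1 (x j)).le

theorem continuous_torusPoisson {d : ℕ} {ϱ : ℝ} (h0 : 0 ≤ ϱ) (h1 : ϱ < 1) :
    Continuous (torusPoisson (d := d) ϱ) :=
  continuous_finsetProd _ fun j _ => (continuous_circlePoisson h0 h1).comp (continuous_apply j)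

theorem torusPoisson_sub_comm {d : ℕ} (ϱ : ℝ) (x y : Torus d) :
    torusPoisson ϱ (x - y) = torusPoisson ϱ (y - x) :=
  Finset.prod_congr rfl fun j _ => by
    rw [← circlePoisson_neg]; simp

theorem torusPoisson_term {d : ℕ} (ϱ : ℝ) (k : Fin d → ℤ) (x : Torus d) :
    ∏ j, ((ϱ : ℂ) ^ (k j).natAbs * fourier (k j) (x j))
      = ((ϱ ^ l1Norm k : ℝ) : ℂ) * expMonomial k x := by
  rw [Finset.prod_mul_distrib, Finset.prod_pow_eq_pow_sum]
  simp [l1Norm, expMonomial]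

theorem hasSum_torusPoisson {d : ℕ} {ϱ : ℝ} (h0 : 0 ≤ ϱ) (h1 : ϱ < 1) (x : Torus d) :
    HasSum (fun k => ((ϱ ^ l1Norm k : ℝ) : ℂ) * expMonomial k x) (torusPoisson ϱ x : ℂ) := by
  have h := (hasSum_pi_prod (f := fun (j : Fin d) k => (ϱ : ℂ) ^ k.natAbs * fourier k (x j))
    fun j => (hasSum_circlePoisson h0 h1 (x j)).summable.norm).2
  simp only [torusPoisson_term, (hasSum_circlePoisson h0 h1 _).tsum_eq] at h
  rwa [torusPoisson, Complex.ofReal_prod]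

theorem radialSummable_pow (d : ℕ) {ϱ : ℝ} (h0 : 0 ≤ ϱ) (h1 : ϱ < 1) :
    RadialSummable d fun ν => ϱ ^ ν := by
  have h := (hasSum_torusPoisson (d := d) h0 h1 0).summable.norm
  refine .of_norm (h.congr fun k => ?_)
  rw [norm_mul, norm_expMonomial, Complex.norm_real, mul_one]

theorem exists_hasSum_l1Norm_mul_torusPoisson {d : ℕ} {ϱ : ℝ} (h0 : 0 ≤ ϱ) (h1 : ϱ < 1)
    (x : Torus d) :
    ∃ q : ℂ, HasSum (fun k => ((l1Norm k * ϱ ^ l1Norm k : ℝ) : ℂ) * expMonomial k x) q ∧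
      ‖q‖ ≤ 2 * d / (1 - ϱ) * torusPoisson ϱ x := by
  choose q hq hq' using fun j => exists_hasSum_natAbs_mul_circlePoisson h0 h1 (x j)
  let F : Fin d → Fin d → ℤ → ℂ := fun i j k =>
    (if j = i then (k.natAbs : ℂ) else 1) * ((ϱ : ℂ) ^ k.natAbs * fourier k (x j))
  have hF : ∀ i j, HasSum (F i j) (if j = i then q j else circlePoisson ϱ (x j)) := by
    intro i j
    by_cases h : j = i
    · simp only [F, if_pos h]
      simpa only [mul_assoc] using hq j
    · simp only [F, if_neg h, one_mul]
      exact hasSum_circlePoisson h0 h1 (x j)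
  have hterm : ∀ i (k : Fin d → ℤ), ∏ j, F i j (k j)
      = ((k i).natAbs : ℂ) * (((ϱ ^ l1Norm k : ℝ) : ℂ) * expMonomial k x) := by
    intro i k
    rw [← torusPoisson_term, Finset.prod_mul_distrib]
    simp
  have hi : ∀ i, HasSum (fun k : Fin d → ℤ =>
      ((k i).natAbs : ℂ) * (((ϱ ^ l1Norm k : ℝ) : ℂ) * expMonomial k x))
      (∏ j, if j = i then q j else (circlePoisson ϱ (x j) : ℂ)) := by
    intro i
    have h := (hasSum_pi_prod (f := F i) fun j => (hF i j).summable.norm).2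
    simpa only [hterm, (hF i _).tsum_eq] using h
  refine ⟨_, HasSum.congr_fun (hasSum_sum fun i (_ : i ∈ Finset.univ) => hi i) fun k => ?_, ?_⟩
  · rw [← Finset.sum_mul, l1Norm]
    push_cast
    ring
  · refine (norm_sum_le _ _).trans ?_
    have : ∀ i, ‖∏ j, if j = i then q j else (circlePoisson ϱ (x j) : ℂ)‖
        ≤ 2 / (1 - ϱ) * torusPoisson ϱ x := by
      intro i
      calc ‖∏ j, if j = i then q j else (circlePoisson ϱ (x j) : ℂ)‖
          = ∏ j, ‖if j = i then q j else (circlePoisson ϱ (x j) : ℂ)‖ := norm_prod _ _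
        _ ≤ ∏ j, (if j = i then 2 / (1 - ϱ) else 1) * circlePoisson ϱ (x j) := by
            refine Finset.prod_le_prod (fun j _ => norm_nonneg _) fun j _ => ?_
            by_cases h : j = i
            · simpa only [if_pos h] using hq' j
            · simp only [if_neg h, one_mul, Complex.norm_real]
              exact (Real.norm_of_nonneg (circlePoisson_pos h0 h1 _).le).le
        _ = 2 / (1 - ϱ) * torusPoisson ϱ x := by
            rw [Finset.prod_mul_distrib, torusPoisson]; simp
    refine (Finset.sum_le_sum fun i _ => this i).trans_eq ?_
    simp; ring

theorem radialSummable_natCast_mul_pow (d : ℕ) {ϱ : ℝ} (h0 : 0 ≤ ϱ) (h1 : ϱ < 1) :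
    RadialSummable d fun ν => ν * ϱ ^ ν := by
  obtain ⟨q, hq, -⟩ := exists_hasSum_l1Norm_mul_torusPoisson (d := d) h0 h1 0
  refine .of_norm (hq.summable.norm.congr fun k => ?_)
  rw [norm_mul, norm_expMonomial, Complex.norm_real, mul_one]

/-- A radial multiplier is the convolution with its kernel. -/
theorem radialMult_eq_integral {d : ℕ} {a : ℕ → ℝ} (ha : RadialSummable d a) {f : Torus d → ℂ}
    (hf : Integrable f (torusMeasure d)) (x : Torus d) :
    radialMult a f x = ∫ y, f y * ∑' k : Fin d → ℤ, (a (l1Norm k) : ℂ) * expMonomial k (x - y)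
      ∂(torusMeasure d) := by
  let F : (Fin d → ℤ) → Torus d → ℂ := fun k y =>
    (a (l1Norm k) * expMonomial k x) * (f y * (starRingEnd ℂ) (expMonomial k y))
  have hF : ∀ k, Integrable (F k) (torusMeasure d) := fun k =>
    (integrable_mul_conj_expMonomial hf k).const_mul _
  have hn : ∀ k y, ‖F k y‖ = |a (l1Norm k)| * ‖f y‖ := by
    intro k y; simp [F, norm_expMonomial]
  have hs : Summable fun k => ∫ y, ‖F k y‖ ∂(torusMeasure d) := by
    simp_rw [hn, integral_const_mul]
    exact ha.norm_bound f
  have key := integral_tsum_of_summable_integral_norm hF hs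
  have e1 : ∀ y, ∑' k, F k y
      = f y * ∑' k : Fin d → ℤ, (a (l1Norm k) : ℂ) * expMonomial k (x - y) := by
    intro y
    rw [← tsum_mul_left]
    exact tsum_congr fun k => by simp only [F, expMonomial_sub]; ring
  simp_rw [e1] at key
  rw [← key, radialMult]
  refine tsum_congr fun k => ?_
  rw [integral_const_mul, ← torusCoeff]
  ring

/-- The Poisson kernel is a probability density. -/
theorem lintegral_torusPoisson_sub {d : ℕ} {ϱ : ℝ} (h0 : 0 ≤ ϱ) (h1 : ϱ < 1) (x : Torus d) :
    ∫⁻ y, ENNReal.ofReal (torusPoisson ϱ (x - y)) ∂(torusMeasure d) = 1 := by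
  have hc : Continuous fun y => torusPoisson ϱ (x - y) :=
    (continuous_torusPoisson h0 h1).comp (by fun_prop)
  have hi : Integrable (fun y => torusPoisson ϱ (x - y)) (torusMeasure d) := by
    have := memLp_one_iff_integrable.1
      (memLp_of_continuous (Complex.continuous_ofReal.comp hc) 1)
    simpa using! this.re
  rw [← ofReal_integral_eq_lintegral_ofReal hi (.of_forall fun y => torusPoisson_nonneg h0 h1 _),
    ENNReal.ofReal_eq_one]
  -- The kernel integrates to its coefficient at `0`: apply the operator to the constant `e_0 = 1`.
  have h := radialMult_eq_integral (radialSummable_pow d h0 h1) (f := expMonomial 0)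
    (memLp_one_iff_integrable.1 (memLp_of_continuous (continuous_expMonomial 0) 1)) x
  rw [radialMult, tsum_eq_single 0 (by
    intro k hk; rw [torusCoeff_expMonomial, if_neg hk.symm]; simp)] at h
  simp_rw [(hasSum_torusPoisson h0 h1 _).tsum_eq] at h
  have e0 : ∀ y : Torus d, expMonomial 0 y = 1 := fun y => by simp [expMonomial]
  simp only [e0, torusCoeff_expMonomial, l1Norm, one_mul, integral_complex_ofReal] at h
  have h' : ((1 : ℝ) : ℂ) = ((∫ y, torusPoisson ϱ (x - y) ∂(torusMeasure d) : ℝ) : ℂ) := by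
    rw [← h]; simp
  exact (Complex.ofReal_injective h').symm

/-- A radial multiplier whose kernel is dominated by `C` times the Poisson kernel has norm at most
`C` on `L_p`. -/
theorem torusNorm_radialMult_le_of_kernel {d : ℕ} {p : ℝ≥0∞} (hp : 1 ≤ p) {ϱ : ℝ} (h0 : 0 ≤ ϱ)
    (h1 : ϱ < 1) {a : ℕ → ℝ} (ha : RadialSummable d a) {C : ℝ} (hC : 0 ≤ C)
    (hK : ∀ x : Torus d,
      ‖∑' k : Fin d → ℤ, (a (l1Norm k) : ℂ) * expMonomial k x‖ ≤ C * torusPoisson ϱ x)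
    {g : Torus d → ℂ} (hg : MemLp g p (torusMeasure d)) :
    torusNorm p (radialMult a g) ≤ C * torusNorm p g := by
  have hgi : Integrable g (torusMeasure d) := hg.integrable hp
  have hc := continuous_torusPoisson (d := d) h0 h1
  have main : eLpNorm (radialMult a g) p (torusMeasure d)
      ≤ ENNReal.ofReal C * eLpNorm g p (torusMeasure d) := by
    refine eLpNorm_le_of_doublyStochastic
      (k := fun x y => ENNReal.ofReal (torusPoisson ϱ (x - y))) ?_
      (lintegral_torusPoisson_sub h0 h1) (fun y => ?_) hp hg.1 fun x => ?_
    · exact ENNReal.measurable_ofReal.comp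
        (hc.comp (continuous_fst.sub continuous_snd)).measurable
    · simp_rw [fun x : Torus d => torusPoisson_sub_comm ϱ x y]
      exact lintegral_torusPoisson_sub h0 h1 y
    · rw [radialMult_eq_integral ha hgi]
      refine (enorm_integral_le_lintegral_enorm _).trans ?_
      rw [← lintegral_const_mul' _ _ ENNReal.ofReal_ne_top]
      refine lintegral_mono fun y => ?_
      rw [← mul_assoc, ← ENNReal.ofReal_mul hC, enorm_mul, mul_comm]
      gcongr
      rw [← ofReal_norm]
      exact ENNReal.ofReal_le_ofReal (hK _)
  rw [torusNorm, torusNorm, ← toReal_eLpNorm hg.1,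
    ← toReal_eLpNorm (memLp_radialMult ha g p).1]
  have := ENNReal.toReal_mono (ENNReal.mul_ne_top ENNReal.ofReal_ne_top hg.eLpNorm_ne_top) main
  rwa [ENNReal.toReal_mul, ENNReal.toReal_ofReal hC] at this

/-! ### Bernstein-type estimates for the Taylor–Abel–Poisson means -/

/-- The radial multiplier with symbol `a` is given by an absolutely convergent series and has norm
at most `C` on `L_p(𝕋ᵈ)`. -/
structure HasRadialBound (d : ℕ) (p : ℝ≥0∞) (a : ℕ → ℝ) (C : ℝ) : Prop where
  summable : RadialSummable d a
  le : ∀ g : Torus d → ℂ, MemLp g p (torusMeasure d) →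
    torusNorm p (radialMult a g) ≤ C * torusNorm p g

theorem torusNorm_nonneg {d : ℕ} (p : ℝ≥0∞) (f : Torus d → ℂ) : 0 ≤ torusNorm p f :=
  lpNorm_nonneg

namespace HasRadialBound

variable {d : ℕ} {p : ℝ≥0∞} {a b : ℕ → ℝ} {A B : ℝ}

theorem mono (h : HasRadialBound d p a A) (hAB : A ≤ B) : HasRadialBound d p a B :=
  ⟨h.summable, fun g hg => (h.le g hg).trans
    (mul_le_mul_of_nonneg_right hAB (torusNorm_nonneg p g))⟩

theorem zero : HasRadialBound d p 0 0 := by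
  refine ⟨summable_zero, fun g _ => ?_⟩
  have : radialMult 0 g = 0 := by funext x; simp [radialMult]
  simp [this, torusNorm]

theorem add (hp : 1 ≤ p) (ha : HasRadialBound d p a A) (hb : HasRadialBound d p b B) :
    HasRadialBound d p (a + b) (A + B) := by
  refine ⟨ha.summable.add hb.summable, fun g hg => ?_⟩
  rw [radialMult_add ha.summable hb.summable, add_mul]
  exact (lpNorm_add_le (memLp_radialMult ha.summable g p) hp).trans
    (add_le_add (ha.le g hg) (hb.le g hg))

theorem smul (c : ℝ) (ha : HasRadialBound d p a A) : HasRadialBound d p (c • a) (|c| * A) := by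
  refine ⟨Summable.mul_left c ha.summable, fun g hg => ?_⟩
  rw [radialMult_smul, torusNorm, lpNorm_const_smul, mul_assoc]
  exact mul_le_mul_of_nonneg_left (ha.le g hg) (abs_nonneg c)

theorem mul (hA : 0 ≤ A) (ha : HasRadialBound d p a A) (hb : HasRadialBound d p b B) :
    HasRadialBound d p (a * b) (A * B) := by
  refine ⟨ha.summable.mul hb.summable, fun g hg => ?_⟩
  rw [← radialMult_comp a hb.summable, mul_assoc]
  exact (ha.le _ (memLp_radialMult hb.summable g p)).trans
    (mul_le_mul_of_nonneg_left (hb.le g hg) hA)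

theorem sum (hp : 1 ≤ p) {ι : Type*} (s : Finset ι) {a : ι → ℕ → ℝ} {A : ι → ℝ}
    (h : ∀ i ∈ s, HasRadialBound d p (a i) (A i)) :
    HasRadialBound d p (∑ i ∈ s, a i) (∑ i ∈ s, A i) := by
  classical
  induction s using Finset.induction_on with
  | empty => simpa using zero
  | insert i s hi ih =>
    rw [Finset.sum_insert hi, Finset.sum_insert hi]
    exact (h i (by simp)).add hp (ih fun j hj => h j (by simp [hj]))

end HasRadialBound

/-- The sequence `q` acts after Poisson smoothing like a derivative of order `s`: the multiplier
with symbol `q(ν) ϱ^ν` has norm `O((1 - ϱ)^{-s})` on `L_p(𝕋ᵈ)` as `ϱ → 1-`. -/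
def PoissonOrder (d : ℕ) (p : ℝ≥0∞) (s : ℕ) (q : ℕ → ℝ) : Prop :=
  ∃ C : ℝ, 0 ≤ C ∧ ∀ ϱ : ℝ, 1 / 2 ≤ ϱ → ϱ < 1 →
    HasRadialBound d p (fun ν => q ν * ϱ ^ ν) (C * ((1 - ϱ) ^ s)⁻¹)

namespace PoissonOrder

variable {d : ℕ} {p : ℝ≥0∞} {s t : ℕ} {q u : ℕ → ℝ}

theorem mono (h : PoissonOrder d p s q) (hst : s ≤ t) : PoissonOrder d p t q := by
  obtain ⟨C, hC, h⟩ := h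
  refine ⟨C, hC, fun ϱ h0 h1 => (h ϱ h0 h1).mono ?_⟩
  have : 0 < 1 - ϱ := by linarith
  gcongr C * (?_)⁻¹
  exact pow_le_pow_of_le_one this.le (by linarith) hst

theorem add (hp : 1 ≤ p) (hq : PoissonOrder d p s q) (hu : PoissonOrder d p s u) :
    PoissonOrder d p s (q + u) := by
  obtain ⟨C, hC, hq⟩ := hq
  obtain ⟨D, hD, hu⟩ := hu
  refine ⟨C + D, add_nonneg hC hD, fun ϱ h0 h1 => ?_⟩
  convert (hq ϱ h0 h1).add hp (hu ϱ h0 h1) using 1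
  · funext ν; simp [add_mul]
  · ring

theorem const_smul (c : ℝ) (hq : PoissonOrder d p s q) : PoissonOrder d p s (c • q) := by
  obtain ⟨C, hC, hq⟩ := hq
  refine ⟨|c| * C, by positivity, fun ϱ h0 h1 => ?_⟩
  convert (hq ϱ h0 h1).smul c using 1
  · funext ν; simp [mul_assoc]
  · ring

/-- Splitting `ϱ^ν = √ϱ^ν √ϱ^ν` gives one smoothing factor to each of the two symbols. -/
theorem mul (hq : PoissonOrder d p s q) (hu : PoissonOrder d p t u) :
    PoissonOrder d p (s + t) (q * u) := by
  obtain ⟨C, hC, hq⟩ := hq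
  obtain ⟨D, hD, hu⟩ := hu
  refine ⟨2 ^ (s + t) * (C * D), by positivity, fun ϱ h0 h1 => ?_⟩
  have hs0 : 0 ≤ √ϱ := Real.sqrt_nonneg ϱ
  have hsq : √ϱ ^ 2 = ϱ := Real.sq_sqrt (by linarith)
  have hs1 : √ϱ < 1 := by rw [Real.sqrt_lt' one_pos]; simpa using h1
  have hs2 : 1 / 2 ≤ √ϱ := by nlinarith
  have hpos : 0 < 1 - √ϱ := by linarith
  have hpos' : 0 < 1 - ϱ := by linarith
  have hinv : ∀ j : ℕ, ((1 - √ϱ) ^ j)⁻¹ ≤ 2 ^ j * ((1 - ϱ) ^ j)⁻¹ := by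
    intro j
    rw [← inv_pow, ← inv_pow, ← mul_pow]
    gcongr
    rw [inv_le_iff_one_le_mul₀ hpos, mul_assoc, ← div_eq_inv_mul, ← mul_div_assoc,
      le_div_iff₀ hpos']
    nlinarith
  convert HasRadialBound.mono ((hq √ϱ hs2 hs1).mul (by positivity) (hu √ϱ hs2 hs1)) ?_ using 1
  · funext ν
    simp only [Pi.mul_apply]
    nth_rewrite 1 [← hsq]
    ring
  · calc C * ((1 - √ϱ) ^ s)⁻¹ * (D * ((1 - √ϱ) ^ t)⁻¹)
        ≤ C * (2 ^ s * ((1 - ϱ) ^ s)⁻¹) * (D * (2 ^ t * ((1 - ϱ) ^ t)⁻¹)) := by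
          gcongr <;> exact hinv _
      _ = 2 ^ (s + t) * (C * D) * ((1 - ϱ) ^ (s + t))⁻¹ := by
          rw [pow_add, pow_add, mul_inv]; ring

theorem one (hp : 1 ≤ p) : PoissonOrder d p 0 1 := by
  refine ⟨1, zero_le_one, fun ϱ h0 h1 => ?_⟩
  have h0' : 0 ≤ ϱ := by linarith
  have hs := radialSummable_pow d h0' h1
  have h : HasRadialBound d p (fun ν => ϱ ^ ν) 1 := by
    refine ⟨hs, fun g hg => torusNorm_radialMult_le_of_kernel hp h0' h1 hs zero_le_one
      (fun x => ?_) hg⟩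
    rw [(hasSum_torusPoisson h0' h1 x).tsum_eq, Complex.norm_real, one_mul,
      Real.norm_of_nonneg (torusPoisson_nonneg h0' h1 x)]
  simpa using h

theorem natCast (hp : 1 ≤ p) : PoissonOrder d p 1 fun ν => (ν : ℝ) := by
  refine ⟨2 * d, by positivity, fun ϱ h0 h1 => ?_⟩
  have h0' : 0 ≤ ϱ := by linarith
  have h1' : 0 < 1 - ϱ := by linarith
  have hs := radialSummable_natCast_mul_pow d h0' h1
  rw [pow_one, ← div_eq_mul_inv]
  refine ⟨hs, fun g hg => torusNorm_radialMult_le_of_kernel hp h0' h1 hs (by positivity)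
    (fun x => ?_) hg⟩
  obtain ⟨q, hq, hq'⟩ := exists_hasSum_l1Norm_mul_torusPoisson h0' h1 x
  rwa [hq.tsum_eq]

theorem descFactorial (hp : 1 ≤ p) (i : ℕ) :
    PoissonOrder d p i fun ν => (ν.descFactorial i : ℝ) := by
  induction i with
  | zero => simpa using! one hp
  | succ i ih =>
    have h := ih.mul ((natCast hp).add hp (((one hp).const_smul (-(i : ℝ))).mono zero_le_one))
    convert h using 1
    funext ν
    simp only [Pi.mul_apply, Pi.add_apply, Pi.smul_apply, Pi.one_apply, smul_eq_mul, mul_one]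
    rcases le_or_gt i ν with h | h
    · rw [Nat.descFactorial_succ, Nat.cast_mul, Nat.cast_sub h]; ring
    · rw [Nat.descFactorial_eq_zero_iff_lt.2 h, Nat.descFactorial_eq_zero_iff_lt.2 (by omega)]
      simp

theorem choose (hp : 1 ≤ p) (i : ℕ) : PoissonOrder d p i fun ν => (ν.choose i : ℝ) := by
  convert (descFactorial hp i).const_smul ((i.factorial : ℝ)⁻¹) using 1
  funext ν
  rw [Pi.smul_apply, Nat.descFactorial_eq_factorial_mul_choose, smul_eq_mul, Nat.cast_mul,
    inv_mul_cancel_left₀ (by positivity)]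

end PoissonOrder

/-- The formula for `ν ≥ r` also holds for `ν < r`, by the binomial theorem. -/
theorem tapLambda_eq_sum (r ν : ℕ) (ϱ : ℝ) :
    tapLambda r ν ϱ
      = ∑ j ∈ Finset.range r, (ν.choose j : ℝ) * (1 - ϱ) ^ j * ϱ ^ (ν - j) := by
  rw [tapLambda]
  split_ifs with h
  · have h1 := add_pow (1 - ϱ) ϱ ν
    rw [sub_add_cancel, one_pow] at h1
    refine h1.trans ?_
    refine Eq.trans (Finset.sum_congr rfl fun j _ => by ring)
      (Finset.sum_subset (Finset.range_subset_range.2 h) fun j _ hj => ?_)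
    rw [Finset.mem_range, not_lt] at hj
    rw [Nat.choose_eq_zero_of_lt hj]; simp
  · rfl

/-- Bernstein's inequality for the means `A_{ϱ,r}`: a derivative of order `s` costs a factor
`(1 - ϱ)^{-s}`. -/
theorem PoissonOrder.exists_bound_mul_tapLambda {d : ℕ} {p : ℝ≥0∞} (hp : 1 ≤ p) {s : ℕ}
    {q : ℕ → ℝ} (hq : PoissonOrder d p s q) (r : ℕ) :
    ∃ C : ℝ, 0 ≤ C ∧ ∀ ϱ : ℝ, 1 / 2 ≤ ϱ → ϱ < 1 →
      HasRadialBound d p (fun ν => q ν * tapLambda r ν ϱ) (C * ((1 - ϱ) ^ s)⁻¹) := by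
  choose C hC hb using fun j => hq.mul (PoissonOrder.choose (d := d) hp j)
  refine ⟨∑ j ∈ Finset.range r, 2 ^ j * C j,
    Finset.sum_nonneg fun j _ => mul_nonneg (by positivity) (hC j), fun ϱ h0 h1 => ?_⟩
  have hpos : 0 < 1 - ϱ := by linarith
  have hϱ : 0 < ϱ := by linarith
  convert HasRadialBound.sum hp (Finset.range r) (A := fun j => 2 ^ j * C j * ((1 - ϱ) ^ s)⁻¹)
    (a := fun j => ((1 - ϱ) ^ j * (ϱ ^ j)⁻¹) •
      fun ν => (q * fun ν : ℕ => (ν.choose j : ℝ)) ν * ϱ ^ ν)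
    (fun j _ => ((hb j ϱ h0 h1).smul _).mono ?_) using 1
  · funext ν
    rw [tapLambda_eq_sum, Finset.mul_sum, Finset.sum_apply]
    refine Finset.sum_congr rfl fun j _ => ?_
    simp only [Pi.smul_apply, Pi.mul_apply, smul_eq_mul]
    rcases le_or_gt j ν with h | h
    · rw [pow_sub₀ ϱ hϱ.ne' h]; ring
    · rw [Nat.choose_eq_zero_of_lt h]; simp
  · rw [Finset.sum_mul]
  · have hinv : (ϱ ^ j)⁻¹ ≤ 2 ^ j := by
      rw [← inv_pow]
      gcongr
      rw [inv_le_comm₀ hϱ two_pos]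
      linarith
    rw [abs_of_nonneg (by positivity)]
    have hCj := hC j
    calc (1 - ϱ) ^ j * (ϱ ^ j)⁻¹ * (C j * ((1 - ϱ) ^ (s + j))⁻¹)
        = (ϱ ^ j)⁻¹ * (C j * ((1 - ϱ) ^ s)⁻¹) := by
          rw [pow_add, mul_inv]; field_simp
      _ ≤ 2 ^ j * (C j * ((1 - ϱ) ^ s)⁻¹) := by gcongr
      _ = 2 ^ j * C j * ((1 - ϱ) ^ s)⁻¹ := by ring

theorem radialSummable_tapLambda (d r : ℕ) {ϱ : ℝ} (h0 : 1 / 2 ≤ ϱ) (h1 : ϱ < 1) :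
    RadialSummable d fun ν => tapLambda r ν ϱ := by
  obtain ⟨C, -, h⟩ :=
    (PoissonOrder.one (d := d) le_rfl).exists_bound_mul_tapLambda le_rfl r
  simpa using (h ϱ h0 h1).summable

/-! ### Dyadic sums of the majorant -/

theorem IsMajorant.nonneg {ω : ℝ → ℝ} (hω : IsMajorant ω) {t : ℝ} (h0 : 0 < t) (h1 : t ≤ 1) :
    0 ≤ ω t := by
  refine le_of_tendsto hω.tendsto_zero ?_
  filter_upwards [Ioo_mem_nhdsGT h0] with u hu
  exact hω.monotoneOn ⟨hu.1.le, hu.2.le.trans h1⟩ ⟨h0.le, h1⟩ hu.2.le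

theorem IsMajorant.pos {ω : ℝ → ℝ} (hω : IsMajorant ω) {t : ℝ} (h0 : 0 < t) (h1 : t ≤ 1) :
    0 < ω t :=
  (hω.nonneg h0 h1).lt_of_ne (hω.ne_zero t ⟨h0, h1⟩).symm

theorem tendsto_half_pow_nhdsGT : Tendsto (fun N : ℕ => (1 / 2 : ℝ) ^ N) atTop (𝓝[>] 0) :=
  tendsto_nhdsWithin_iff.2 ⟨tendsto_pow_atTop_nhds_zero_of_lt_one (by norm_num) (by norm_num),
    .of_forall fun N => Set.mem_Ioi.2 (by positivity)⟩

theorem half_pow_le_one (j : ℕ) : (1 / 2 : ℝ) ^ j ≤ 1 :=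
  pow_le_one₀ (by norm_num) (by norm_num)

theorem IsMajorant.intervalIntegrable {ω : ℝ → ℝ} (hω : IsMajorant ω) (n : ℕ) {a b : ℝ}
    (ha : 0 < a) (hb : 0 < b) (ha1 : a ≤ 1) (hb1 : b ≤ 1) :
    IntervalIntegrable (fun t => ω t / t ^ n) volume a b := by
  refine ContinuousOn.intervalIntegrable ?_
  have hsub : ∀ t ∈ Set.uIcc a b, 0 < t ∧ t ≤ 1 := fun t ht =>
    ⟨(lt_min ha hb).trans_le ht.1, ht.2.trans (max_le ha1 hb1)⟩
  refine (hω.continuousOn.mono fun t ht => ⟨(hsub t ht).1.le, (hsub t ht).2⟩).div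
    (continuousOn_id.pow n) fun t ht => pow_ne_zero _ (hsub t ht).1.ne'

/-- Comparison of a dyadic sum with an integral; each term is compared with the integral over the
dyadic interval to the right of its node. -/
theorem IsMajorant.sum_dyadic_le {ω : ℝ → ℝ} (hω : IsMajorant ω) (n : ℕ) {N M : ℕ} (hNM : N ≤ M) :
    ∑ i ∈ Finset.Ico N M, ω ((1 / 2) ^ (i + 1)) / ((1 / 2) ^ (i + 1)) ^ n
      ≤ 2 ^ (n + 1) * ∫ t in ((1 / 2 : ℝ) ^ M)..((1 / 2) ^ N), ω t / t ^ (n + 1) := by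
  have hint : ∀ i j : ℕ, IntervalIntegrable (fun t => ω t / t ^ (n + 1)) volume
      ((1 / 2 : ℝ) ^ i) ((1 / 2 : ℝ) ^ j) := fun i j =>
    hω.intervalIntegrable (n + 1) (by positivity) (by positivity) (half_pow_le_one i)
      (half_pow_le_one j)
  have hsum : ∫ t in ((1 / 2 : ℝ) ^ M)..((1 / 2) ^ N), ω t / t ^ (n + 1)
      = ∑ i ∈ Finset.Ico N M, ∫ t in ((1 / 2 : ℝ) ^ (i + 1))..((1 / 2) ^ i),
        ω t / t ^ (n + 1) := by
    rw [intervalIntegral.integral_symm, ← intervalIntegral.sum_integral_adjacent_intervals_Ico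
      (a := fun i : ℕ => (1 / 2 : ℝ) ^ i) hNM fun k _ => hint _ _, ← Finset.sum_neg_distrib]
    exact Finset.sum_congr rfl fun i _ => (intervalIntegral.integral_symm _ _).symm
  rw [hsum, Finset.mul_sum]
  refine Finset.sum_le_sum fun i _ => ?_
  have ht : (1 / 2 : ℝ) ^ i = 2 * (1 / 2) ^ (i + 1) := by rw [pow_succ]; ring
  have hle := half_pow_le_one i
  set t : ℝ := (1 / 2) ^ (i + 1) with htdef
  have ht0 : 0 < t := by positivity
  have hωt := hω.nonneg ht0 (half_pow_le_one _)
  have hmono : ∫ _ in t..((1 / 2) ^ i), ω t / (2 * t) ^ (n + 1)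
      ≤ ∫ u in t..((1 / 2) ^ i), ω u / u ^ (n + 1) := by
    refine intervalIntegral.integral_mono_on (by linarith) intervalIntegrable_const
      (hint _ _) fun u hu => ?_
    have hu0 : 0 < u := ht0.trans_le hu.1
    have h1 : ω t ≤ ω u := hω.monotoneOn ⟨ht0.le, half_pow_le_one _⟩
      ⟨hu0.le, hu.2.trans hle⟩ hu.1
    have h2 : u ≤ 2 * t := ht ▸ hu.2
    gcongr
    exact hωt.trans h1
  rw [intervalIntegral.integral_const, ht, smul_eq_mul] at hmono
  rw [ht]
  calc ω t / t ^ n = 2 ^ (n + 1) * ((2 * t - t) * (ω t / (2 * t) ^ (n + 1))) := by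
        rw [mul_pow, pow_succ t]; field_simp; ring
    _ ≤ _ := by gcongr

/-- The discrete form of condition `(𝒵)`. -/
theorem IsMajorant.dyadic_tail {ω : ℝ → ℝ} (hω : IsMajorant ω) (hZ : CondZ ω) :
    Summable (fun j : ℕ => ω ((1 / 2) ^ j)) ∧
      ∃ C : ℝ, ∀ᶠ N : ℕ in atTop,
        ∑' j : ℕ, ω ((1 / 2) ^ (N + 1 + j)) ≤ C * ω ((1 / 2) ^ N) := by
  have hnn : ∀ j : ℕ, 0 ≤ ω ((1 / 2) ^ j) := fun j =>
    hω.nonneg (by positivity) (half_pow_le_one j)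
  have hint : IntervalIntegrable (fun t => ω t / t) volume 0 1 :=
    (intervalIntegrable_iff_integrableOn_Ioc_of_le zero_le_one).2 hZ.integrableOn
  have hsum : ∀ N K : ℕ, ∑ j ∈ Finset.range K, ω ((1 / 2) ^ (N + 1 + j))
      ≤ 2 * ∫ t in (0 : ℝ)..((1 / 2) ^ N), ω t / t := by
    intro N K
    have h := hω.sum_dyadic_le 0 (Nat.le_add_right N K)
    simp only [zero_add, pow_one, pow_zero, div_one] at h
    rw [Finset.sum_Ico_eq_sum_range, Nat.add_sub_cancel_left] at h
    refine (le_of_eq ?_).trans (h.trans ?_)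
    · exact Finset.sum_congr rfl fun j _ => by congr 2; ring
    · refine mul_le_mul_of_nonneg_left ?_ zero_le_two
      have hN := half_pow_le_one N
      have hK : (1 / 2 : ℝ) ^ (N + K) ≤ (1 / 2) ^ N :=
        pow_le_pow_of_le_one (by norm_num) (by norm_num) (Nat.le_add_right N K)
      refine intervalIntegral.integral_mono_interval (by positivity) hK le_rfl ?_
        (hint.mono_set ?_)
      · filter_upwards [ae_restrict_mem measurableSet_Ioc] with t ht
        exact div_nonneg (hω.nonneg ht.1 (ht.2.trans hN)) ht.1.le
      · rw [Set.uIcc_of_le (by positivity), Set.uIcc_of_le zero_le_one]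
        exact Set.Icc_subset_Icc_right hN
  have hsummable : Summable (fun j : ℕ => ω ((1 / 2) ^ j)) := by
    have : Summable (fun j : ℕ => ω ((1 / 2) ^ (0 + 1 + j))) :=
      summable_of_sum_range_le (fun j => hnn _) (hsum 0)
    refine (summable_nat_add_iff 1).1 (this.congr fun j => ?_)
    rw [zero_add, add_comm]
  refine ⟨hsummable, ?_⟩
  obtain ⟨c, hc⟩ := (hZ.isBigO.comp_tendsto tendsto_half_pow_nhdsGT).bound
  refine ⟨2 * c, ?_⟩
  filter_upwards [hc] with N hN
  simp only [Function.comp_apply, Real.norm_eq_abs, abs_of_nonneg (hnn N)] at hN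
  calc ∑' j : ℕ, ω ((1 / 2) ^ (N + 1 + j)) ≤ 2 * ∫ t in (0 : ℝ)..((1 / 2) ^ N), ω t / t :=
        Real.tsum_le_of_sum_range_le (fun j => hnn _) (hsum N)
    _ ≤ 2 * (c * ω ((1 / 2) ^ N)) :=
        mul_le_mul_of_nonneg_left ((le_abs_self _).trans hN) zero_le_two
    _ = 2 * c * ω ((1 / 2) ^ N) := by ring

/-- The discrete form of condition `(𝒵_n)`. -/
theorem IsMajorant.dyadic_head {ω : ℝ → ℝ} (hω : IsMajorant ω) {n : ℕ} (hZn : CondZn n ω) :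
    ∃ C : ℝ, ∀ᶠ N : ℕ in atTop,
      ∑ i ∈ Finset.range N, ω ((1 / 2) ^ (i + 1)) / ((1 / 2) ^ (i + 1)) ^ n
        ≤ C * (ω ((1 / 2) ^ N) / ((1 / 2) ^ N) ^ n) := by
  obtain ⟨c, hc⟩ := (IsBigO.comp_tendsto hZn tendsto_half_pow_nhdsGT).bound
  refine ⟨2 ^ (n + 1) * c, ?_⟩
  filter_upwards [hc] with N hN
  have hnn : 0 ≤ ω ((1 / 2) ^ N) / ((1 / 2) ^ N) ^ n :=
    div_nonneg (hω.nonneg (by positivity) (half_pow_le_one N)) (by positivity)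
  simp only [Function.comp_apply, Real.norm_eq_abs] at hN
  rw [abs_of_nonneg hnn] at hN
  have h := hω.sum_dyadic_le n (Nat.zero_le N)
  rw [← Finset.range_eq_Ico, pow_zero] at h
  refine h.trans ?_
  rw [mul_assoc]
  gcongr
  exact (le_abs_self _).trans hN

/-! ### Limits in `L_p` -/

theorem norm_torusCoeff_le_torusNorm {d : ℕ} {p : ℝ≥0∞} (hp : 1 ≤ p) {f : Torus d → ℂ}
    (hf : MemLp f p (torusMeasure d)) (k : Fin d → ℤ) : ‖torusCoeff f k‖ ≤ torusNorm p f := by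
  refine (norm_torusCoeff_le f k).trans ?_
  rw [← lpNorm_one_eq_integral_norm hf.1, torusNorm, ← toReal_eLpNorm hf.1, ← toReal_eLpNorm hf.1]
  exact ENNReal.toReal_mono hf.eLpNorm_ne_top (eLpNorm_le_eLpNorm_of_exponent_le hp hf.1)

/-- Completeness of `L_p(𝕋ᵈ)`, for sequences with summable increments. -/
theorem exists_memLp_limit {d : ℕ} {p : ℝ≥0∞} (hp : 1 ≤ p) {G : ℕ → Torus d → ℂ}
    (hG : ∀ j, MemLp (G j) p (torusMeasure d)) {b : ℕ → ℝ} (hb : Summable b)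
    (hGb : ∀ j, torusNorm p (G (j + 1) - G j) ≤ b j) :
    ∃ g : Torus d → ℂ, MemLp g p (torusMeasure d) ∧
      ∀ N, torusNorm p (g - G N) ≤ ∑' j, b (N + j) := by
  have : Fact (1 ≤ p) := ⟨hp⟩
  have hnorm : ∀ {u : Torus d → ℂ} (hu : MemLp u p (torusMeasure d)),
      ‖hu.toLp u‖ = torusNorm p u := by
    intro u hu
    rw [Lp.norm_toLp, torusNorm, toReal_eLpNorm hu.1]
  have hdist : ∀ j, dist ((hG j).toLp (G j)) ((hG j.succ).toLp (G j.succ)) ≤ b j := by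
    intro j
    rw [dist_comm, dist_eq_norm, ← MemLp.toLp_sub, hnorm]
    exact hGb j
  obtain ⟨g, hg⟩ := cauchySeq_tendsto_of_complete (cauchySeq_of_dist_le_of_summable b hdist hb)
  refine ⟨g, Lp.memLp g, fun N => ?_⟩
  refine le_trans (le_of_eq ?_) (dist_le_tsum_of_dist_le_of_tendsto b hdist hb hg N)
  rw [dist_comm, dist_eq_norm, ← hnorm ((Lp.memLp g).sub (hG N)),
    MemLp.toLp_sub (Lp.memLp g) (hG N), Lp.toLp_coeFn g (Lp.memLp g)]

/-! ### Dyadic decomposition and the inverse theorem -/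

/-- The means `A_ϱ` commute, so `A_σ f - A_ϱ f = A_σ (f - A_ϱ f) - A_ϱ (f - A_σ f)`. Hence
Bernstein's inequality applies to the increments, although they are not polynomials. -/
theorem PoissonOrder.exists_increment_bound {d : ℕ} {p : ℝ≥0∞} (hp : 1 ≤ p) {s : ℕ}
    {q : ℕ → ℝ} (hq : PoissonOrder d p s q) (r : ℕ) :
    ∃ C : ℝ, 0 ≤ C ∧ ∀ (f : Torus d → ℂ) (ϱ σ : ℝ), MemLp f p (torusMeasure d) →
      1 / 2 ≤ ϱ → ϱ ≤ σ → σ < 1 →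
      torusNorm p (radialMult (fun ν => q ν * tapLambda r ν σ) f
          - radialMult (fun ν => q ν * tapLambda r ν ϱ) f)
        ≤ C * ((1 - σ) ^ s)⁻¹ * (torusNorm p (f - tapMean ϱ r f)
          + torusNorm p (f - tapMean σ r f)) := by
  obtain ⟨C, hC, hb⟩ := hq.exists_bound_mul_tapLambda hp r
  refine ⟨C, hC, fun f ϱ σ hf h0 h1 h2 => ?_⟩
  have hsϱ := radialSummable_tapLambda d r h0 (h1.trans_lt h2)
  have hsσ := radialSummable_tapLambda d r (h0.trans h1) h2
  have hbϱ := hb ϱ h0 (h1.trans_lt h2)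
  have hbσ := hb σ (h0.trans h1) h2
  have hfi := hf.integrable hp
  rw [tapMean_eq_radialMult hsϱ, tapMean_eq_radialMult hsσ]
  have key : radialMult (fun ν => q ν * tapLambda r ν σ) f
        - radialMult (fun ν => q ν * tapLambda r ν ϱ) f
      = radialMult (fun ν => q ν * tapLambda r ν σ)
          (f - radialMult (fun ν => tapLambda r ν ϱ) f)
        - radialMult (fun ν => q ν * tapLambda r ν ϱ)
          (f - radialMult (fun ν => tapLambda r ν σ) f) := by
    rw [radialMult_sub hbσ.summable hfi (integrable_radialMult hsϱ f),
      radialMult_sub hbϱ.summable hfi (integrable_radialMult hsσ f),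
      radialMult_comp _ hsϱ, radialMult_comp _ hsσ]
    have : (fun ν => q ν * tapLambda r ν ϱ) * (fun ν => tapLambda r ν σ)
        = (fun ν => q ν * tapLambda r ν σ) * fun ν => tapLambda r ν ϱ := by
      funext ν; simp only [Pi.mul_apply]; ring
    rw [this]; abel
  have hpos : 0 < 1 - σ := by linarith
  rw [key, mul_add]
  refine (lpNorm_sub_le (memLp_radialMult hbσ.summable _ p) hp).trans (add_le_add ?_ ?_)
  · exact hbσ.le _ (hf.sub (memLp_radialMult hsϱ f p))
  · refine (hbϱ.le _ (hf.sub (memLp_radialMult hsσ f p))).trans ?_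
    refine mul_le_mul_of_nonneg_right ?_ (torusNorm_nonneg _ _)
    gcongr

/-- The multiplier with symbol `q(ν) λ_{ν,r}(1 - 2^{-j})` applied to `f`: for `q = 1` this is the
mean `A_{ϱ,r}(f)` at the dyadic node `ϱ = 1 - 2^{-j}`. -/
noncomputable def dyadicMean {d : ℕ} (q : ℕ → ℝ) (r : ℕ) (f : Torus d → ℂ) (j : ℕ) : Torus d → ℂ :=
  radialMult (fun ν => q ν * tapLambda r ν (1 - (1 / 2) ^ j)) f

theorem half_le_one_sub_half_pow {j : ℕ} (hj : 1 ≤ j) : (1 / 2 : ℝ) ≤ 1 - (1 / 2) ^ j := by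
  have : (1 / 2 : ℝ) ^ j ≤ (1 / 2) ^ 1 := pow_le_pow_of_le_one (by norm_num) (by norm_num) hj
  linarith

theorem one_sub_half_pow_lt_one (j : ℕ) : 1 - (1 / 2 : ℝ) ^ j < 1 :=
  sub_lt_self _ (by positivity)

theorem PoissonOrder.radialSummable_dyadic {d : ℕ} {p : ℝ≥0∞} (hp : 1 ≤ p) {s : ℕ} {q : ℕ → ℝ}
    (hq : PoissonOrder d p s q) (r : ℕ) {j : ℕ} (hj : 1 ≤ j) :
    RadialSummable d fun ν => q ν * tapLambda r ν (1 - (1 / 2) ^ j) := by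
  obtain ⟨C, -, hb⟩ := hq.exists_bound_mul_tapLambda hp r
  exact (hb _ (half_le_one_sub_half_pow hj) (one_sub_half_pow_lt_one j)).summable

/-- The increments of the dyadic means of a function with approximation order
`(1 - ϱ)^m ω(1 - ϱ)`. -/
theorem PoissonOrder.eventually_dyadicMean_sub_le {d : ℕ} {p : ℝ≥0∞} (hp : 1 ≤ p) {s : ℕ}
    {q : ℕ → ℝ} (hq : PoissonOrder d p s q) {r m : ℕ} {f : Torus d → ℂ}
    (hf : MemLp f p (torusMeasure d)) {ω : ℝ → ℝ} (hω : IsMajorant ω)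
    (happrox : (fun ϱ : ℝ => torusNorm p (f - tapMean ϱ r f))
      =O[𝓝[<] 1] fun ϱ : ℝ => (1 - ϱ) ^ m * ω (1 - ϱ)) :
    ∃ C : ℝ, 0 ≤ C ∧ ∀ᶠ j : ℕ in atTop,
      torusNorm p (dyadicMean q r f (j + 1) - dyadicMean q r f j)
        ≤ C * (((1 / 2) ^ j) ^ m * ω ((1 / 2) ^ j) / ((1 / 2) ^ j) ^ s) := by
  obtain ⟨C, hC, hinc⟩ := hq.exists_increment_bound hp r
  obtain ⟨K, hK, hO⟩ := happrox.exists_nonneg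
  have htend : Tendsto (fun j : ℕ => 1 - (1 / 2 : ℝ) ^ j) atTop (𝓝[<] 1) := by
    refine tendsto_nhdsWithin_iff.2 ⟨?_, .of_forall one_sub_half_pow_lt_one⟩
    simpa using! (tendsto_nhdsWithin_iff.1 tendsto_half_pow_nhdsGT).1.const_sub 1
  have hev : ∀ᶠ j : ℕ in atTop, torusNorm p (f - tapMean (1 - (1 / 2) ^ j) r f)
      ≤ K * (((1 / 2) ^ j) ^ m * ω ((1 / 2) ^ j)) := by
    filter_upwards [htend.eventually hO.bound] with j hj
    have hnn := hω.nonneg (t := (1 / 2) ^ j) (by positivity) (half_pow_le_one j)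
    rwa [Real.norm_of_nonneg (torusNorm_nonneg _ _), sub_sub_cancel,
      Real.norm_of_nonneg (by positivity)] at hj
  refine ⟨C * 2 ^ s * (2 * K), by positivity, ?_⟩
  filter_upwards [hev, (tendsto_add_atTop_nat 1).eventually hev, eventually_ge_atTop 1]
    with j h1 h2 hj
  have hle : (1 / 2 : ℝ) ^ (j + 1) ≤ (1 / 2) ^ j :=
    pow_le_pow_of_le_one (by norm_num) (by norm_num) (Nat.le_succ j)
  have h := hinc f (1 - (1 / 2) ^ j) (1 - (1 / 2) ^ (j + 1)) hf (half_le_one_sub_half_pow hj)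
    (by linarith) (one_sub_half_pow_lt_one _)
  refine h.trans ?_
  have hnn := hω.nonneg (t := (1 / 2) ^ j) (by positivity) (half_pow_le_one j)
  have h2' : torusNorm p (f - tapMean (1 - (1 / 2) ^ (j + 1)) r f)
      ≤ K * (((1 / 2) ^ j) ^ m * ω ((1 / 2) ^ j)) := by
    refine h2.trans ?_
    have hmono : ω ((1 / 2) ^ (j + 1)) ≤ ω ((1 / 2) ^ j) :=
      hω.monotoneOn ⟨by positivity, half_pow_le_one _⟩ ⟨by positivity, half_pow_le_one _⟩ hle
    have hnn' := hω.nonneg (t := (1 / 2) ^ (j + 1)) (by positivity) (half_pow_le_one _)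
    gcongr
  calc C * ((1 - (1 - (1 / 2 : ℝ) ^ (j + 1))) ^ s)⁻¹ *
        (torusNorm p (f - tapMean (1 - (1 / 2) ^ j) r f)
          + torusNorm p (f - tapMean (1 - (1 / 2) ^ (j + 1)) r f))
      ≤ C * ((1 - (1 - (1 / 2 : ℝ) ^ (j + 1))) ^ s)⁻¹ *
        (K * (((1 / 2) ^ j) ^ m * ω ((1 / 2) ^ j))
          + K * (((1 / 2) ^ j) ^ m * ω ((1 / 2) ^ j))) := by
        rw [sub_sub_cancel]
        gcongr
    _ = C * 2 ^ s * (2 * K) * (((1 / 2) ^ j) ^ m * ω ((1 / 2) ^ j) / ((1 / 2) ^ j) ^ s) := by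
        rw [sub_sub_cancel, pow_succ, mul_pow, mul_inv, ← inv_pow (1 / 2 : ℝ)]
        norm_num
        ring

theorem tendsto_tapLambda_dyadic {r : ℕ} (hr : 1 ≤ r) (ν : ℕ) :
    Tendsto (fun j : ℕ => tapLambda r ν (1 - (1 / 2) ^ j)) atTop (𝓝 1) := by
  have hc : Continuous fun t : ℝ => tapLambda r ν (1 - t) := by
    simp_rw [tapLambda_eq_sum]; fun_prop
  have h0 : tapLambda r ν (1 - 0) = 1 := by
    obtain ⟨r, rfl⟩ := Nat.exists_eq_add_of_le' hr
    rw [tapLambda_eq_sum, Finset.sum_range_succ']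
    simp
  have h : Tendsto (fun t => tapLambda r ν (1 - t)) (𝓝 0) (𝓝 (tapLambda r ν (1 - 0))) :=
    hc.tendsto 0
  rw [h0] at h
  exact h.comp (tendsto_nhdsWithin_iff.1 tendsto_half_pow_nhdsGT).1

theorem isRadialDeriv_of_coeff {d m : ℕ} {f g : Torus d → ℂ} (hf : Integrable f (torusMeasure d))
    (hg : Integrable g (torusMeasure d))
    (h : ∀ k, torusCoeff g k = ((l1Norm k).descFactorial m : ℝ) * torusCoeff f k) :
    IsRadialDeriv m f g := by
  refine ⟨hf, hg, fun k => ?_⟩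
  rw [h k]
  split_ifs with hk
  · rw [Nat.descFactorial_eq_zero_iff_lt.2 hk]; simp
  · rw [not_lt] at hk
    congr 1
    have h1 : ((l1Norm k - m).factorial : ℂ) ≠ 0 := Nat.cast_ne_zero.2 (Nat.factorial_ne_zero _)
    rw [eq_div_iff h1, ← Nat.factorial_mul_descFactorial hk]
    push_cast; ring

theorem zero_mem_lowerBounds_kFunctional {d : ℕ} (n : ℕ) (p : ℝ≥0∞) {δ : ℝ} (hδ : 0 ≤ δ)
    (f : Torus d → ℂ) :
    0 ∈ lowerBounds {a : ℝ | ∃ h g : Torus d → ℂ, MemLp h p (torusMeasure d) ∧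
      MemLp g p (torusMeasure d) ∧ IsRadialDeriv n h g ∧
      a = torusNorm p (f - h) + δ ^ n * torusNorm p g} := by
  rintro a ⟨h, g, -, -, -, rfl⟩
  have h1 := torusNorm_nonneg p (f - h)
  have h2 := torusNorm_nonneg p g
  positivity

/-- If the functions `h_N` and their derivatives satisfy `‖g - h_N‖ = O(ω(2^{-N}))` and
`‖h_N^{[n]}‖ = O(2^{Nn} ω(2^{-N}))`, then `K_n(δ, g) = O(ω(δ))`. -/
theorem kFunctional_isBigO_of_dyadic {d n : ℕ} {p : ℝ≥0∞} {g : Torus d → ℂ} {ω : ℝ → ℝ}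
    (hω : IsMajorant ω) {G H : ℕ → Torus d → ℂ} {A B : ℝ} (hA : 0 ≤ A) (hB : 0 ≤ B)
    (hev : ∀ᶠ N : ℕ in atTop, MemLp (G N) p (torusMeasure d) ∧ MemLp (H N) p (torusMeasure d) ∧
      IsRadialDeriv n (G N) (H N) ∧ torusNorm p (g - G N) ≤ A * ω ((1 / 2) ^ N) ∧
      torusNorm p (H N) ≤ B * (ω ((1 / 2) ^ N) / ((1 / 2) ^ N) ^ n)) :
    (fun δ : ℝ => kFunctional n p δ g) =O[𝓝[>] 0] ω := by
  obtain ⟨N₀, hN₀⟩ := eventually_atTop.1 hev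
  refine IsBigO.of_bound (A + B * 2 ^ n) ?_
  have hpos : (0 : ℝ) < (1 / 2) ^ N₀ := by positivity
  filter_upwards [Ioo_mem_nhdsGT hpos] with δ hδ
  have hδ1 : δ ≤ 1 := hδ.2.le.trans (half_pow_le_one _)
  -- Choose the node with `2^{-(M+1)} < δ ≤ 2 · 2^{-(M+1)}`.
  obtain ⟨M, hM1, hM2⟩ := exists_nat_pow_near_of_lt_one hδ.1 hδ1
    (show (0 : ℝ) < 1 / 2 by norm_num) (by norm_num)
  have hN : N₀ ≤ M + 1 := by
    by_contra hlt
    have : (1 / 2 : ℝ) ^ N₀ ≤ (1 / 2) ^ (M + 1) :=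
      pow_le_pow_of_le_one (by norm_num) (by norm_num) (not_le.1 hlt).le
    linarith [hδ.2]
  obtain ⟨h1, h2, h3, h4, h5⟩ := hN₀ _ hN
  have hb := zero_mem_lowerBounds_kFunctional n p hδ.1.le g
  have hK0 : 0 ≤ kFunctional n p δ g := Real.sInf_nonneg fun a ha => hb ha
  have hωδ := hω.nonneg hδ.1 hδ1
  rw [Real.norm_of_nonneg hK0, Real.norm_of_nonneg hωδ]
  have hmono : ω ((1 / 2) ^ (M + 1)) ≤ ω δ :=
    hω.monotoneOn ⟨by positivity, half_pow_le_one _⟩ ⟨hδ.1.le, hδ1⟩ hM1.le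
  have hδ2 : δ ≤ 2 * (1 / 2) ^ (M + 1) := hM2.trans_eq (by rw [pow_succ]; ring)
  have hω' := hω.nonneg (t := (1 / 2) ^ (M + 1)) (by positivity) (half_pow_le_one _)
  have ht : (0 : ℝ) < (1 / 2) ^ (M + 1) := by positivity
  set t : ℝ := (1 / 2) ^ (M + 1)
  have hδ0 := hδ.1
  calc kFunctional n p δ g
      ≤ torusNorm p (g - G (M + 1)) + δ ^ n * torusNorm p (H (M + 1)) :=
        csInf_le ⟨0, hb⟩ ⟨_, _, h1, h2, h3, rfl⟩
    _ ≤ A * ω t + (2 * t) ^ n * (B * (ω t / t ^ n)) := by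
        gcongr
        exact torusNorm_nonneg _ _
    _ = (A + B * 2 ^ n) * ω t := by rw [mul_pow]; field_simp
    _ ≤ (A + B * 2 ^ n) * ω δ := by gcongr

theorem theorem2 (d : ℕ) (hd : 1 ≤ d) (p : ℝ≥0∞) (hp : 1 ≤ p) (n r : ℕ) (hn : 1 ≤ n) (hnr : n ≤ r)
    (f : Torus d → ℂ) (hf : MemLpY p f)
    (ω : ℝ → ℝ) (hω : IsMajorant ω) (hZ : CondZ ω) (hZn : CondZn n ω)
    (happrox : (fun ϱ : ℝ => torusNorm p (f - tapMean ϱ r f))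
      =O[𝓝[<] 1] fun ϱ : ℝ => (1 - ϱ) ^ (r - n) * ω (1 - ϱ)) :
    ∃ g : Torus d → ℂ, IsRadialDeriv (r - n) f g ∧ MemLp g p (torusMeasure d) ∧
      (fun δ : ℝ => kFunctional n p δ g) =O[𝓝[>] 0] ω := by
  have hfp := hf.memLp
  set m := r - n with hm
  have hq₁ := PoissonOrder.descFactorial (d := d) hp m
  have hq₂ := hq₁.mul (PoissonOrder.descFactorial hp n)
  set q₁ : ℕ → ℝ := fun ν => (ν.descFactorial m : ℝ) with hq₁def
  set q₂ : ℕ → ℝ := q₁ * fun ν => (ν.descFactorial n : ℝ) with hq₂def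
  obtain ⟨C₁, hC₁, hev₁⟩ := hq₁.eventually_dyadicMean_sub_le hp hfp hω happrox
  obtain ⟨C₂, hC₂, hev₂⟩ := hq₂.eventually_dyadicMean_sub_le hp hfp hω happrox
  obtain ⟨N₀, hN₀⟩ := eventually_atTop.1 ((hev₁.and hev₂).and (eventually_ge_atTop 1))
  have hN₀1 : 1 ≤ N₀ := (hN₀ N₀ le_rfl).2
  have hωnn : ∀ j : ℕ, 0 ≤ ω ((1 / 2) ^ j) := fun j =>
    hω.nonneg (by positivity) (half_pow_le_one j)
  set G := dyadicMean q₁ r f with hG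
  set H := dyadicMean q₂ r f with hH
  have hGs : ∀ {j}, 1 ≤ j → RadialSummable d fun ν => q₁ ν * tapLambda r ν (1 - (1 / 2) ^ j) :=
    fun hj => hq₁.radialSummable_dyadic hp r hj
  have hHs : ∀ {j}, 1 ≤ j → RadialSummable d fun ν => q₂ ν * tapLambda r ν (1 - (1 / 2) ^ j) :=
    fun hj => hq₂.radialSummable_dyadic hp r hj
  have hGp : ∀ {j}, 1 ≤ j → MemLp (G j) p (torusMeasure d) :=
    fun hj => memLp_radialMult (hGs hj) f p
  have hHp : ∀ {j}, 1 ≤ j → MemLp (H j) p (torusMeasure d) :=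
    fun hj => memLp_radialMult (hHs hj) f p
  have hGc : ∀ {j}, 1 ≤ j → ∀ k, torusCoeff (G j) k
      = ((q₁ (l1Norm k) * tapLambda r (l1Norm k) (1 - (1 / 2) ^ j) : ℝ) : ℂ) * torusCoeff f k :=
    fun hj k => torusCoeff_radialMult (hGs hj) f k
  have hHc : ∀ {j}, 1 ≤ j → ∀ k, torusCoeff (H j) k
      = ((q₂ (l1Norm k) * tapLambda r (l1Norm k) (1 - (1 / 2) ^ j) : ℝ) : ℂ) * torusCoeff f k :=
    fun hj k => torusCoeff_radialMult (hHs hj) f k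
  have hGinc : ∀ j, N₀ ≤ j → torusNorm p (G (j + 1) - G j) ≤ C₁ * ω ((1 / 2) ^ j) := by
    intro j hj
    refine (hN₀ j hj).1.1.trans_eq ?_
    have : ((1 / 2 : ℝ) ^ j) ^ m ≠ 0 := by positivity
    rw [mul_div_cancel_left₀ _ this]
  have hHinc : ∀ j, N₀ ≤ j →
      torusNorm p (H (j + 1) - H j) ≤ C₂ * (ω ((1 / 2) ^ j) / ((1 / 2) ^ j) ^ n) := by
    intro j hj
    refine (hN₀ j hj).1.2.trans_eq ?_
    have : ((1 / 2 : ℝ) ^ j) ^ m ≠ 0 := by positivity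
    rw [pow_add, mul_div_mul_left _ _ this]
  obtain ⟨hωsum, C₃, hC₃⟩ := hω.dyadic_tail hZ
  obtain ⟨C₄, hC₄⟩ := hω.dyadic_head hZn
  -- The derivative is the limit of the differentiated dyadic means.
  have hbsum : Summable fun i : ℕ => C₁ * ω ((1 / 2) ^ (N₀ + i)) := by
    refine ((summable_nat_add_iff N₀).2 hωsum).mul_left C₁ |>.congr fun i => ?_
    rw [add_comm]
  obtain ⟨g, hgp, hglim⟩ := exists_memLp_limit hp (G := fun i => G (N₀ + i))
    (fun i => hGp (by omega)) hbsum fun i => hGinc _ (Nat.le_add_right _ _)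
  have hgc : ∀ k, torusCoeff g k = ((l1Norm k).descFactorial m : ℝ) * torusCoeff f k := by
    intro k
    have hl1 : Tendsto (fun i => torusCoeff (G (N₀ + i)) k) atTop (𝓝 (torusCoeff g k)) := by
      rw [tendsto_iff_norm_sub_tendsto_zero]
      refine squeeze_zero (fun _ => norm_nonneg _) (fun i => ?_)
        ((tendsto_sum_nat_add fun i => C₁ * ω ((1 / 2) ^ (N₀ + i))))
      have hGi : MemLp (G (N₀ + i)) p (torusMeasure d) := hGp (by omega)
      rw [norm_sub_rev, ← torusCoeff_sub (hgp.integrable hp) (hGi.integrable hp)]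
      refine (norm_torusCoeff_le_torusNorm hp (hgp.sub hGi) k).trans ((hglim i).trans_eq ?_)
      exact tsum_congr fun j => by rw [add_comm i j]
    have hl2 : Tendsto (fun i => torusCoeff (G (N₀ + i)) k) atTop
        (𝓝 (((q₁ (l1Norm k) * 1 : ℝ) : ℂ) * torusCoeff f k)) := by
      have h := (tendsto_tapLambda_dyadic (hn.trans hnr) (l1Norm k)).const_mul (q₁ (l1Norm k))
      have h' := ((Complex.continuous_ofReal.tendsto _).comp h).mul_const (torusCoeff f k)
      have hshift : Tendsto (fun i => N₀ + i) atTop atTop :=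
        tendsto_atTop_mono (fun i => Nat.le_add_left i N₀) tendsto_id
      exact (h'.comp hshift).congr fun i => (hGc (by omega) k).symm
    rw [tendsto_nhds_unique hl1 hl2, mul_one]
  -- The partial sums of `(𝒵_n)` dominate every constant, since their first term is positive.
  let S : ℕ → ℝ := fun N => ∑ i ∈ Finset.range N,
    ω ((1 / 2) ^ (i + 1)) / ((1 / 2) ^ (i + 1)) ^ n
  have hSmono : Monotone S := fun a b hab => Finset.sum_le_sum_of_subset_of_nonneg
    (Finset.range_subset_range.2 hab) fun i _ _ => div_nonneg (hωnn _) (by positivity)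
  have hS1 : 0 < S 1 := by
    have := hω.pos (t := 1 / 2) (by norm_num) (by norm_num)
    simp only [S, Finset.sum_range_one, zero_add, pow_one]
    positivity
  have hHbound : ∀ N, N₀ ≤ N + 1 → torusNorm p (H (N + 1)) ≤ torusNorm p (H N₀) + C₂ * S N := by
    intro N hN
    induction N with
    | zero =>
      obtain rfl : N₀ = 1 := le_antisymm hN hN₀1
      simp [S]
    | succ N ih =>
      rcases hN.eq_or_lt with h | h
      · rw [← h]
        have : 0 ≤ S (N + 1) := hS1.le.trans (hSmono (by omega))
        have := mul_nonneg hC₂ this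
        linarith
      · have hN' : N₀ ≤ N + 1 := by omega
        have h1 := hHinc (N + 1) hN'
        have h2 : torusNorm p (H (N + 1 + 1))
            ≤ torusNorm p (H (N + 1)) + torusNorm p (H (N + 1 + 1) - H (N + 1)) :=
          lpNorm_le_lpNorm_add_lpNorm_sub' (hHp (by omega)) hp
        have h3 : S (N + 1) = S N + ω ((1 / 2) ^ (N + 1)) / ((1 / 2) ^ (N + 1)) ^ n :=
          Finset.sum_range_succ _ _
        rw [h3, mul_add]
        linarith [ih hN']
  have hC₃' : ∀ᶠ N : ℕ in atTop, torusNorm p (g - G (N + 1)) ≤ C₁ * |C₃| * ω ((1 / 2) ^ N) := by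
    filter_upwards [hC₃, eventually_ge_atTop N₀] with N h1 h2
    obtain ⟨i, rfl⟩ := Nat.exists_eq_add_of_le h2
    refine (hglim (i + 1)).trans ?_
    rw [tsum_mul_left, mul_assoc]
    refine mul_le_mul_of_nonneg_left ?_ hC₁
    refine (le_of_eq ?_).trans (h1.trans (mul_le_mul_of_nonneg_right (le_abs_self _) (hωnn _)))
    exact tsum_congr fun j => by rw [← add_assoc, ← add_assoc]
  set B := torusNorm p (H N₀) / S 1 + C₂ with hB
  have hB0 : 0 ≤ B := add_nonneg (div_nonneg (torusNorm_nonneg _ _) hS1.le) hC₂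
  refine ⟨g, isRadialDeriv_of_coeff (hfp.integrable hp) (hgp.integrable hp) hgc, hgp,
    kFunctional_isBigO_of_dyadic hω (G := fun N => G (N + 1)) (H := fun N => H (N + 1))
      (A := C₁ * |C₃|) (B := B * |C₄|) (by positivity) (by positivity) ?_⟩
  filter_upwards [hC₃', hC₄, eventually_ge_atTop N₀] with N h1 h2 h3
  refine ⟨hGp (by omega), hHp (by omega), isRadialDeriv_of_coeff
    ((hGp (by omega)).integrable hp) ((hHp (by omega)).integrable hp) fun k => ?_, h1, ?_⟩
  · rw [hGc (by omega), hHc (by omega)]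
    simp only [hq₂def, Pi.mul_apply]
    push_cast; ring
  · have h4 : S 1 ≤ S N := hSmono (hN₀1.trans h3)
    have h5 : torusNorm p (H N₀) ≤ torusNorm p (H N₀) / S 1 * S N := by
      rw [div_mul_eq_mul_div, le_div_iff₀ hS1]
      exact mul_le_mul_of_nonneg_left h4 (torusNorm_nonneg _ _)
    have h6 : 0 ≤ ω ((1 / 2) ^ N) / ((1 / 2) ^ N) ^ n := div_nonneg (hωnn N) (by positivity)
    calc torusNorm p (H (N + 1)) ≤ torusNorm p (H N₀) + C₂ * S N := hHbound N (by omega)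
      _ ≤ B * S N := by rw [hB, add_mul]; linarith
      _ ≤ B * (|C₄| * (ω ((1 / 2) ^ N) / ((1 / 2) ^ N) ^ n)) := by
          refine mul_le_mul_of_nonneg_left (h2.trans ?_) hB0
          exact mul_le_mul_of_nonneg_right (le_abs_self _) h6
      _ = B * |C₄| * (ω ((1 / 2) ^ N) / ((1 / 2) ^ N) ^ n) := by ring
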